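/- All graphs are simple. $d_G$ is the shortest-path distance of $G$. A graph is 4-chordal if each of its induced cycles has length at most $4$. A geodesic triangle of $G$ consists of three vertices $x,y,z$ and three shortest paths $P(x,y),P(x,z),P(y,z)$ of $G$ (for $x,y,z$ in the same component); it is $\delta$-slim if every vertex of each of the three paths is at distance at most $\delta$ from some vertex of the union of the two other paths. The slimness of $G$ is the smallest $\delta$ such that all geodesic triangles of $G$ are $\delta$-slim. Let $p\ne q$ be two vertices. We use three kinds of *arms on* $(p,q)$: - a *dotted arm*: a new vertex adjacent to $p$ and $q$, where the ("dotted") edge $pq$ may or may not be present; - a *building* with $k\ge 1$ squares: vertices $p=p_0,p_1,\dots,p_k$, $q=q_0,q_1,\dots,q_k$ and $r$, with the edges $p_iq_i$ ($0\le i\le k$), $p_ip_{i+1}$ and $q_iq_{i+1}$ ($0\le i<k$), $rp_k$ and $rq_k$; - a *square*: new vertices $p_1,q_1$ and the edges $pq$, $pp_1$, $qq_1$, $p_1q_1$. The forbidden graphs are the following; different arms have no vertices in common, and there are no edges besides those listed. (I) *Two-armed graphs.* Vertices $a,t,c,w,b,v$, the edges $ac,ab,tc,tb,tw,tv$, an arm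 on $(c,w)$ and an arm on $(b,v)$. The arm on $(c,w)$ is a dotted arm or a building with $k\ge1$ squares; the arm on $(b,v)$ is a dotted arm or a square (four types). (II) *Three-armed graphs.* Vertices $a,t,t',c,w,b,v$, the edges $ac,ab,tc,tb,t'c,t'b,tw,t'v$, and arms on $(c,w)$, on $(b,v)$ and on $(t,t')$, each of which is a dotted arm or a building with at least one square (six types up to the symmetry that exchanges $c,w,t$ with $b,v,t'$). All choices of the dotted edges and all numbers of squares in the buildings are allowed, independently for each arm. **Theorem.** For every 4-chordal graph $G$ the following two statements are equivalent: (i) $G$ and each of its induced subgraphs has slimness at most $1$; (ii) none of the forbidden graphs of (I) and (II) is an induced subgraph of $G$. -/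

import Mathlib

namespace SlimGraph

open SimpleGraph

/-- `G` is `k`-chordal: every induced cycle of `G` has length at most `k`. -/
def IsKChordal {V : Type*} (k : ℕ) (G : SimpleGraph V) : Prop :=
  ∀ n : ℕ, 3 ≤ n → cycleGraph n ⊴ G → n ≤ k

/-- A walk is a shortest path if its length is the distance of its ends. -/
def IsShortest {V : Type*} {G : SimpleGraph V} {x y : V} (p : G.Walk x y) : Prop :=
  p.length = G.dist x y

/-- The side `P` of a triangle lies in the `δ`-neighbourhood of the union of the sides `Q`, `R`. -/
def SideClose {V : Type*} (G : SimpleGraph V) (δ : ℕ∞) (P Q R : List V) : Prop :=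
  ∀ u ∈ P, ∃ v, (v ∈ Q ∨ v ∈ R) ∧ G.edist u v ≤ δ

/-- `G` is `δ`-slim: in every geodesic triangle, formed by shortest paths `P(x,y)`, `P(x,z)`,
`P(y,z)`, each side lies in the `δ`-neighbourhood of the union of the two others. -/
def IsSlim {V : Type*} (G : SimpleGraph V) (δ : ℕ∞) : Prop :=
  ∀ (x y z : V) (p : G.Walk x y) (q : G.Walk x z) (r : G.Walk y z),
    IsShortest p → IsShortest q → IsShortest r →
      SideClose G δ p.support q.support r.support ∧
      SideClose G δ q.support p.support r.support ∧
      SideClose G δ r.support p.support q.support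

/-- The slimness of `G`: the smallest `δ` for which `G` is `δ`-slim (`⊤` if no finite one works). -/
noncomputable def slimness {V : Type*} (G : SimpleGraph V) : ℕ∞ :=
  sInf {δ : ℕ∞ | IsSlim G δ}

theorem isSlim_top {V : Type*} (G : SimpleGraph V) : IsSlim G ⊤ := by
  intro x y z p q r _ _ _
  exact ⟨fun _ _ => ⟨x, Or.inl q.start_mem_support, le_top⟩,
    fun _ _ => ⟨x, Or.inl p.start_mem_support, le_top⟩,
    fun _ _ => ⟨y, Or.inl p.end_mem_support, le_top⟩⟩

/-- The infimum in the definition of the slimness is a minimum. -/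
theorem isLeast_slimness {V : Type*} (G : SimpleGraph V) :
    IsLeast {δ : ℕ∞ | IsSlim G δ} (slimness G) :=
  ⟨csInf_mem ⟨⊤, isSlim_top G⟩, fun _ h => sInf_le h⟩

/-- A graph with two distinguished vertices `p`, `q`, used as one arm of a forbidden graph. -/
structure Arm where
  V : Type
  graph : SimpleGraph V
  p : V
  q : V

/-- A vertex (`none`) adjacent to the two vertices `p`, `q`; the (dotted) edge `pq` is present
exactly when `e` is true. -/
def dottedArm (e : Bool) : Arm where
  V := Option Bool
  graph := fromEdgeSet ({s(none, some false), s(none, some true)} ∪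
    {d | e = true ∧ d = s(some false, some true)})
  p := some false
  q := some true

/-- The ladder with the `k + 1` rungs `(i, false) (i, true)`: a chain of `k` squares. -/
def ladder (k : ℕ) : SimpleGraph (Fin (k + 1) × Bool) :=
  pathGraph (k + 1) □ (⊤ : SimpleGraph Bool)

/-- The building `B(w|pq)`: a chain of `k` squares that starts at the edge `pq` and ends with a
triangle; the last vertex `w = none` is adjacent to both ends of the last rung. -/
def building (k : ℕ) : Arm where
  V := Option (Fin (k + 1) × Bool)
  graph := (ladder k).map Function.Embedding.some ⊔
    fromEdgeSet {s(none, some (Fin.last k, false)), s(none, some (Fin.last k, true))}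
  p := some (0, false)
  q := some (0, true)

/-- A single square containing the edge `pq`. Glued below, it forms a house together with the
vertex `t`. -/
def squareArm : Arm where
  V := Fin 2 × Bool
  graph := ladder 1
  p := (0, false)
  q := (0, true)

/-- Disjoint arms `A` (with `p = c`, `q = w`) and `B` (with `p = b`, `q = v`), two new vertices
`a = 0`, `t = 1`, and the edges `ac`, `ab`, `tc`, `tb`, `tw`, `tv`. -/
def twoArms (A B : Arm) : SimpleGraph ((A.V ⊕ B.V) ⊕ Fin 2) :=
  ((A.graph ⊕g B.graph) ⊕g (⊥ : SimpleGraph (Fin 2))) ⊔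
    fromEdgeSet
      {s(.inr 0, .inl (.inl A.p)), s(.inr 0, .inl (.inr B.p)),
       s(.inr 1, .inl (.inl A.p)), s(.inr 1, .inl (.inr B.p)),
       s(.inr 1, .inl (.inl A.q)), s(.inr 1, .inl (.inr B.q))}

/-- Disjoint arms `A` (with `p = c`, `q = w`), `B` (with `p = b`, `q = v`) and `C` (with `p = t`,
`q = t'`), one new vertex `a`, and the edges `ac`, `ab`, `tc`, `tb`, `t'c`, `t'b`, `tw`, `t'v`. -/
def threeArms (A B C : Arm) : SimpleGraph ((A.V ⊕ B.V) ⊕ (C.V ⊕ Unit)) :=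
  ((A.graph ⊕g B.graph) ⊕g (C.graph ⊕g (⊥ : SimpleGraph Unit))) ⊔
    fromEdgeSet
      {s(.inr (.inr ()), .inl (.inl A.p)), s(.inr (.inr ()), .inl (.inr B.p)),
       s(.inr (.inl C.p), .inl (.inl A.p)), s(.inr (.inl C.p), .inl (.inr B.p)),
       s(.inr (.inl C.q), .inl (.inl A.p)), s(.inr (.inl C.q), .inl (.inr B.p)),
       s(.inr (.inl C.p), .inl (.inl A.q)), s(.inr (.inl C.q), .inl (.inr B.q))}

/-- The ten kinds of forbidden graphs. The Boolean parameters record which dotted edges are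
present; a building that appears here has at least one square. -/
inductive Forbidden : ∀ {W : Type}, SimpleGraph W → Prop
  | two_dotted_dotted (d e : Bool) : Forbidden (twoArms (dottedArm d) (dottedArm e))
  | two_building_dotted (k : ℕ) (e : Bool) :
      Forbidden (twoArms (building (k + 1)) (dottedArm e))
  | two_dotted_square (d : Bool) : Forbidden (twoArms (dottedArm d) squareArm)
  | two_building_square (k : ℕ) : Forbidden (twoArms (building (k + 1)) squareArm)
  | three_dotted_dotted_dotted (d e f : Bool) :
      Forbidden (threeArms (dottedArm d) (dottedArm e) (dottedArm f))
  | three_building_dotted_dotted (k : ℕ) (e f : Bool) :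
      Forbidden (threeArms (building (k + 1)) (dottedArm e) (dottedArm f))
  | three_dotted_dotted_building (d e : Bool) (m : ℕ) :
      Forbidden (threeArms (dottedArm d) (dottedArm e) (building (m + 1)))
  | three_building_building_dotted (k l : ℕ) (f : Bool) :
      Forbidden (threeArms (building (k + 1)) (building (l + 1)) (dottedArm f))
  | three_building_dotted_building (k : ℕ) (e : Bool) (m : ℕ) :
      Forbidden (threeArms (building (k + 1)) (dottedArm e) (building (m + 1)))
  | three_building_building_building (k l m : ℕ) :
      Forbidden (threeArms (building (k + 1)) (building (l + 1)) (building (m + 1)))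

end SlimGraph

/-!
# Slimness at most one in 4-chordal graphs

*Forbidden graphs are not slim.* In each of them the vertex `a` has no neighbours besides `b` and
`c`. Take the path from the top of one arm over `c`, `a`, `b` to the top of the other, and let the
two other sides of the triangle pass through `w`, `t` and `v` (or `w`, `t` and `v`, `t'`), so that
they miss `a`, `b` and `c`. That all these walks are shortest paths is certified by functions on the
vertices which change by at most one along edges (`isShortest_of_potential`). The arms enter only
through such a function and two descending walks (`Tower`).

*A triangle that is not slim yields a forbidden graph.* The hypothesis on induced cycles is used
only in the form of `exists_common_or_square`: an edge whose ends are joined by a detour spans a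
triangle or a square with vertices of that detour. By descending level by level towards a vertex
`x`, this produces a dotted arm or a building on every pair of vertices that are equally far from
`x` and have a common neighbour further away (`exists_roof`).

Suppose that `a` is a vertex of the side `P(x,y)` whose closed neighbourhood misses `P(x,z)` and
`P(y,z)`, and let `c`, `b` be its neighbours on `P(x,y)`. The detour from `c` to `b` over the other
two sides contains a common neighbour `t` of `c` and `b` (`exists_common_neighbor`), say on
`P(x,z)`. The vertex `w` before `t` on that side is on the level of `c`, which gives the arm on
`(c,w)`. If `P(y,z)` stays on levels above `t`, or if `t` has a neighbour outside the neighbourhood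
of `a` on the level of `b` as seen from `y`, then the last neighbour `v` of `t` on a suitable walk
to `y` gives the arm on `(b,v)`, and a two-armed graph arises (`hasForbidden_of_two`). Otherwise
`P(y,z)` contains a vertex `t'` as far from `x`, `y` and `z` as `t`. By `adj_of_level`, after a
change of `c`, both `t` and `t'` are adjacent to `b` and `c`; now arms descend to `x`, `y` and `z`,
and a three-armed graph arises (`hasForbidden_of_three`).
-/

namespace SlimGraph

open SimpleGraph

variable {V : Type*} {G : SimpleGraph V}

/-! ### Induced cycles and squares -/

/-- The first `n` values of `f` form an induced cycle, in this order. -/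
theorem cycleGraph_isIndContained {n : ℕ} (f : ℕ → V)
    (hinj : ∀ a b, a < b → b < n → f a ≠ f b)
    (hadj : ∀ a b, a < b → b < n → (G.Adj (f a) (f b) ↔ b = a + 1 ∨ (a = 0 ∧ b + 1 = n))) :
    cycleGraph n ⊴ G := by
  have key : ∀ a b : Fin n, a.val < b.val →
      (G.Adj (f a) (f b) ↔ (cycleGraph n).Adj a b) := by
    intro a b hab
    have h₁ : (a - b).val = n + a - b := Fin.coe_sub_iff_lt.2 hab
    have h₂ : (b - a).val = b - a := Fin.coe_sub_iff_le.2 hab.le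
    rw [hadj a b hab b.isLt, cycleGraph_adj', h₁, h₂]
    omega
  refine ⟨⟨⟨fun k => f k, fun a b h => ?_⟩, fun {a b} => ?_⟩⟩
  · rcases lt_trichotomy a.val b.val with hab | hab | hab
    · exact (hinj _ _ hab b.isLt h).elim
    · exact Fin.ext hab
    · exact (hinj _ _ hab a.isLt h.symm).elim
  · change G.Adj (f a) (f b) ↔ _
    rcases lt_trichotomy a.val b.val with hab | hab | hab
    · exact key a b hab
    · have := Fin.ext hab
      subst this
      simp
    · rw [G.adj_comm, (cycleGraph n).adj_comm]
      exact key b a hab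

/-- The only use of 4-chordality. If the ends of an edge `uv` are joined by a walk through other
vertices, then some vertex of that walk is adjacent to both of them, or some edge `ee'` on vertices
of the walk forms a square with `uv`: a shortest detour from `u` to `v` among the vertices of the
walk closes up with `uv` to an induced cycle. -/
theorem exists_common_or_square (h4 : IsKChordal 4 G) {u v : V} (huv : G.Adj u v) {e₁ e₂ : V}
    (p : G.Walk e₁ e₂) (h₁ : G.Adj u e₁) (h₂ : G.Adj v e₂) (hu : u ∉ p.support)
    (hv : v ∉ p.support) :
    (∃ e ∈ p.support, G.Adj u e ∧ G.Adj v e) ∨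
      ∃ e ∈ p.support, ∃ e' ∈ p.support, G.Adj e e' ∧ G.Adj u e ∧ G.Adj v e' := by
  induction hn : p.length using Nat.strong_induction_on generalizing e₁ e₂ with
  | _ n ih =>
  subst hn
  by_cases hs : ∃ (f₁ f₂ : V) (q : G.Walk f₁ f₂), q.support ⊆ p.support ∧ G.Adj u f₁ ∧
      G.Adj v f₂ ∧ q.length < p.length
  · obtain ⟨f₁, f₂, q, hqp, hf₁, hf₂, hlt⟩ := hs
    rcases ih _ hlt q hf₁ hf₂ (fun h => hu (hqp h)) (fun h => hv (hqp h)) rfl with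
      ⟨e, he, h⟩ | ⟨e, he, e', he', h⟩
    · exact Or.inl ⟨e, hqp he, h⟩
    · exact Or.inr ⟨e, hqp he, e', hqp he', h⟩
  push Not at hs
  -- Now `p` is a shortest detour, so that its vertices have no adjacencies but the obvious ones.
  have hdrop : ∀ k, (p.drop k).support ⊆ p.support := fun k => (p.isSubwalk_drop k).support_subset
  have htake : ∀ k, (p.take k).support ⊆ p.support := fun k => (p.isSubwalk_take k).support_subset
  have hA : ∀ k, k ≤ p.length → G.Adj u (p.getVert k) → k = 0 := by
    intro k hk h
    have := hs _ _ (p.drop k) (hdrop k) h h₂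
    rw [Walk.drop_length] at this
    omega
  have hB : ∀ k, k ≤ p.length → G.Adj v (p.getVert k) → k = p.length := by
    intro k hk h
    have := hs _ _ (p.take k) (htake k) h₁ h
    rw [Walk.take_length] at this
    omega
  have hC : ∀ k l, k < l → l ≤ p.length → G.Adj (p.getVert k) (p.getVert l) → l = k + 1 := by
    intro k l hkl hl h
    have := hs _ _ ((p.take k).append (Walk.cons h (p.drop l))) (by
      intro e he
      rw [Walk.mem_support_append_iff, Walk.support_cons, List.mem_cons] at he
      rcases he with he | rfl | he
      · exact htake k he
      · exact p.getVert_mem_support k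
      · exact hdrop l he) h₁ h₂
    rw [Walk.length_append, Walk.length_cons, Walk.take_length, Walk.drop_length] at this
    omega
  have hD : ∀ k l, k < l → l ≤ p.length → p.getVert k ≠ p.getVert l := by
    intro k l hkl hl h
    have := hs _ _ ((p.take k).append ((p.drop l).copy h.symm rfl)) (by
      intro e he
      rw [Walk.mem_support_append_iff, Walk.support_copy] at he
      rcases he with he | he
      · exact htake k he
      · exact hdrop l he) h₁ h₂
    rw [Walk.length_append, Walk.length_copy, Walk.take_length, Walk.drop_length] at this
    omega
  rcases Nat.lt_or_ge p.length 2 with hlen | hlen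
  · rcases Nat.lt_or_ge p.length 1 with h0 | h0
    · have : e₁ = e₂ := Walk.eq_of_length_eq_zero (p := p) (by omega)
      subst this
      exact Or.inl ⟨_, p.start_mem_support, h₁, h₂⟩
    · exact Or.inr ⟨_, p.start_mem_support, _, p.end_mem_support,
        Walk.adj_of_length_eq_one (p := p) (by omega), h₁, h₂⟩
  exfalso
  have hgu : ∀ k, p.getVert k ≠ u := fun k h => hu (h ▸ p.getVert_mem_support k)
  have hgv : ∀ k, p.getVert k ≠ v := fun k h => hv (h ▸ p.getVert_mem_support k)
  let f : ℕ → V := fun k => if k ≤ p.length then p.getVert k else if k = p.length + 1 then v else u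
  have f1 : ∀ k, k ≤ p.length → f k = p.getVert k := fun k hk => if_pos hk
  have f2 : f (p.length + 1) = v := by simp [f]
  have f3 : f (p.length + 2) = u := by simp [f]
  have hcyc : cycleGraph (p.length + 3) ⊴ G := by
    refine cycleGraph_isIndContained f ?_ ?_
    · intro k l hkl hl
      rcases Nat.lt_or_ge p.length k with hk | hk
      · obtain rfl : k = p.length + 1 := by omega
        obtain rfl : l = p.length + 2 := by omega
        rw [f2, f3]
        exact huv.ne'
      rw [f1 k hk]
      rcases Nat.lt_or_ge p.length l with hl' | hl'
      · rcases (by omega : l = p.length + 1 ∨ l = p.length + 2) with rfl | rfl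
        · rw [f2]; exact hgv k
        · rw [f3]; exact hgu k
      · rw [f1 l hl']; exact hD k l hkl hl'
    · intro k l hkl hl
      rcases Nat.lt_or_ge p.length k with hk | hk
      · obtain rfl : k = p.length + 1 := by omega
        obtain rfl : l = p.length + 2 := by omega
        rw [f2, f3]
        exact iff_of_true huv.symm (Or.inl rfl)
      rw [f1 k hk]
      rcases Nat.lt_or_ge p.length l with hl' | hl'
      · rcases (by omega : l = p.length + 1 ∨ l = p.length + 2) with rfl | rfl
        · rw [f2, G.adj_comm]
          constructor
          · intro h
            have := hB k hk h
            omega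
          · intro h
            obtain rfl : k = p.length := by omega
            rwa [p.getVert_length]
        · rw [f3, G.adj_comm]
          constructor
          · intro h
            have := hA k hk h
            omega
          · intro h
            obtain rfl : k = 0 := by omega
            rwa [p.getVert_zero]
      · rw [f1 l hl']
        constructor
        · intro h
          exact Or.inl (hC k l hkl hl' h)
        · intro h
          obtain rfl : l = k + 1 := by omega
          exact p.adj_getVert_succ (by omega)
  have := h4 _ (by omega) hcyc
  omega

/-! ### Adjacency in the arms -/

/-- The graph of `dottedArm e` on its explicit vertex type. -/
def dottedGraph (e : Bool) : SimpleGraph (Option Bool) :=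
  (dottedArm e).graph

/-- The graph of `building k` on its explicit vertex type. -/
def buildingGraph (k : ℕ) : SimpleGraph (Option (Fin (k + 1) × Bool)) :=
  (building k).graph

theorem dottedGraph_adj_none (e : Bool) (β : Bool) : (dottedGraph e).Adj none (some β) := by
  cases β <;> simp [dottedGraph, dottedArm]

theorem dottedGraph_adj_some (e : Bool) (β γ : Bool) :
    (dottedGraph e).Adj (some β) (some γ) ↔ e = true ∧ β ≠ γ := by
  cases β <;> cases γ <;> simp [dottedGraph, dottedArm]

theorem ladder_adj (k : ℕ) (i j : Fin (k + 1)) (β γ : Bool) :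
    (ladder k).Adj (i, β) (j, γ) ↔
      (β = γ ∧ (i.val + 1 = j.val ∨ j.val + 1 = i.val)) ∨ (i = j ∧ β ≠ γ) := by
  simp only [ladder, boxProd_adj, pathGraph_adj, top_adj]
  tauto

theorem buildingGraph_adj_none (k : ℕ) (i : Fin (k + 1)) (β : Bool) :
    (buildingGraph k).Adj none (some (i, β)) ↔ i = Fin.last k := by
  constructor
  · rintro (⟨-, u, v, -, hu, -⟩ | h)
    · cases hu
    · cases β <;> simpa using h
  · rintro rfl
    refine Or.inr ?_
    cases β <;> simp

theorem buildingGraph_adj_some (k : ℕ) (i j : Fin (k + 1)) (β γ : Bool) :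
    (buildingGraph k).Adj (some (i, β)) (some (j, γ)) ↔
      (β = γ ∧ (i.val + 1 = j.val ∨ j.val + 1 = i.val)) ∨ (i = j ∧ β ≠ γ) := by
  rw [← ladder_adj]
  constructor
  · rintro (h | h)
    · exact (SimpleGraph.map_adj_apply (f := Function.Embedding.some)).1 h
    · simp at h
  · intro h
    exact Or.inl ((SimpleGraph.map_adj_apply (f := Function.Embedding.some)).2 h)

/-- `G` contains an induced copy of the arm `A` on the pair `(c, w)` whose other vertices all lie
in `S`. -/
def ArmOn (G : SimpleGraph V) (A : Arm) (c w : V) (S : Set V) : Prop :=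
  ∃ φ : A.graph ↪g G, φ A.p = c ∧ φ A.q = w ∧ ∀ s, s ≠ A.p → s ≠ A.q → φ s ∈ S

/-- Dotted arms and buildings with at least one square. -/
def IsRoof (A : Arm) : Prop :=
  (∃ e, A = dottedArm e) ∨ ∃ k, A = building (k + 1)

theorem ArmOn.mono {A : Arm} {c w : V} {S T : Set V} (h : ArmOn G A c w S) (hST : S ⊆ T) :
    ArmOn G A c w T := by
  obtain ⟨φ, h₁, h₂, h₃⟩ := h
  exact ⟨φ, h₁, h₂, fun s hp hq => hST (h₃ s hp hq)⟩

theorem armOn_building {k : ℕ} {c w : V} {S : Set V} :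
    ArmOn G (building k) c w S ↔ ∃ φ : buildingGraph k ↪g G, φ (some (0, false)) = c ∧
      φ (some (0, true)) = w ∧ ∀ s, s ≠ some (0, false) → s ≠ some (0, true) → φ s ∈ S :=
  Iff.rfl

theorem armOn_dottedArm {e : Bool} {c w u : V} {S : Set V} (hcw : c ≠ w) (huc : G.Adj u c)
    (huw : G.Adj u w) (he : G.Adj c w ↔ e = true) (hu : u ∈ S) : ArmOn G (dottedArm e) c w S := by
  let f : Option Bool → V := fun s => s.elim u (fun β => cond β w c)
  have hf : Function.Injective f := by
    rintro (_ | _ | _) (_ | _ | _) h <;>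
      simp_all [f, huc.ne, huc.ne', huw.ne, huw.ne', hcw.symm]
  have hadj : ∀ s s' : Option Bool, G.Adj (f s) (f s') ↔ (dottedGraph e).Adj s s' := by
    have h := dottedGraph_adj_some e
    have h' := dottedGraph_adj_none e
    rintro (_ | _ | _) (_ | _ | _)
    · exact iff_of_false G.irrefl (dottedGraph e).irrefl
    · exact iff_of_true huc (h' _)
    · exact iff_of_true huw (h' _)
    · exact iff_of_true huc.symm (h' _).symm
    · rw [h]; simp
    · rw [h]; simpa [f] using he
    · exact iff_of_true huw.symm (h' _).symm
    · rw [h, G.adj_comm]; simpa [f] using he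
    · rw [h]; simp
  refine ⟨⟨⟨f, hf⟩, fun {a b} => hadj a b⟩, rfl, rfl, ?_⟩
  rintro (_ | _ | _) hp hq
  · exact hu
  · exact (hp rfl).elim
  · exact (hq rfl).elim

theorem armOn_building_zero {c w u : V} {S : Set V} (hcw : G.Adj c w) (huc : G.Adj u c)
    (huw : G.Adj u w) (hu : u ∈ S) : ArmOn G (building 0) c w S := by
  rw [armOn_building]
  have h0 : ∀ i : Fin (0 + 1), i = 0 := fun i => Fin.ext (by omega)
  let f : Option (Fin 1 × Bool) → V := fun s => s.elim u (fun x => cond x.2 w c)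
  have hf : Function.Injective f := by
    rintro (_ | ⟨i, β⟩) (_ | ⟨j, γ⟩) h
    · rfl
    · cases γ
      · exact (huc.ne h).elim
      · exact (huw.ne h).elim
    · cases β
      · exact (huc.ne' h).elim
      · exact (huw.ne' h).elim
    · obtain rfl := h0 i
      obtain rfl := h0 j
      cases β <;> cases γ
      · rfl
      · exact (hcw.ne h).elim
      · exact (hcw.ne' h).elim
      · rfl
  have hadj : ∀ s s' : Option (Fin 1 × Bool), G.Adj (f s) (f s') ↔ (buildingGraph 0).Adj s s' := by
    have h := buildingGraph_adj_some 0
    have h' := fun i β => (buildingGraph_adj_none 0 i β).2 (h0 i)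
    rintro (_ | ⟨i, _ | _⟩) (_ | ⟨j, _ | _⟩)
    · exact iff_of_false G.irrefl (buildingGraph 0).irrefl
    · exact iff_of_true huc (h' _ _)
    · exact iff_of_true huw (h' _ _)
    · exact iff_of_true huc.symm (h' _ _).symm
    · rw [h]; simp [f]
    · rw [h]; simpa [f, h0 i, h0 j] using hcw
    · exact iff_of_true huw.symm (h' _ _).symm
    · rw [h]; simpa [f, h0 i, h0 j] using hcw.symm
    · rw [h]; simp [f]
  refine ⟨⟨⟨f, hf⟩, fun {a b} => hadj a b⟩, rfl, rfl, ?_⟩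
  rintro (_ | ⟨i, _ | _⟩) hp hq
  · exact hu
  · exact (hp (by rw [h0 i])).elim
  · exact (hq (by rw [h0 i])).elim

/-- Adding the square `c`, `w`, `e'`, `e` below a building on `(e, e')`. -/
theorem ArmOn.building_succ {k : ℕ} {c w e e' : V} {S : Set V}
    (h : ArmOn G (building k) e e' S) (hcw : G.Adj c w) (hce : G.Adj c e) (hwe : G.Adj w e')
    (hce' : ¬ G.Adj c e') (hwe' : ¬ G.Adj w e) (hne : c ≠ e') (hne' : w ≠ e)
    (hc : ∀ s ∈ S, c ≠ s ∧ ¬ G.Adj c s) (hw : ∀ s ∈ S, w ≠ s ∧ ¬ G.Adj w s) :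
    ArmOn G (building (k + 1)) c w (S ∪ {e, e'}) := by
  rw [armOn_building] at h ⊢
  obtain ⟨φ, h₁', h₂', h₃⟩ := h
  let f : Option (Fin (k + 2) × Bool) → V := fun s =>
    s.elim (φ none) fun x => Fin.cases (motive := fun _ => V) (cond x.2 w c)
      (fun i => φ (some (i, x.2))) x.1
  have f0 : f none = φ none := rfl
  have f1 : ∀ β, f (some (0, β)) = cond β w c := fun β => rfl
  have f2 : ∀ i β, f (some (Fin.succ i, β)) = φ (some (i, β)) := fun i β => rfl
  have hS : ∀ i β, i ≠ 0 → φ (some (i, β)) ∈ S := by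
    intro i β hi
    exact h₃ _ (fun h => hi (Prod.ext_iff.1 (Option.some.inj h)).1)
      (fun h => hi (Prod.ext_iff.1 (Option.some.inj h)).1)
  have hN : φ none ∈ S := h₃ _ (by rintro ⟨⟩) (by rintro ⟨⟩)
  have hneq : ∀ β s, cond β w c ≠ φ s := by
    rintro β (_ | ⟨i, γ⟩)
    · cases β
      · exact (hc _ hN).1
      · exact (hw _ hN).1
    · by_cases hi : i = 0
      · subst hi
        cases β <;> cases γ
        · exact h₁' ▸ hce.ne
        · exact h₂' ▸ hne
        · exact h₁' ▸ hne'
        · exact h₂' ▸ hwe.ne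
      · cases β
        · exact (hc _ (hS i γ hi)).1
        · exact (hw _ (hS i γ hi)).1
  have hadN : ∀ β, ¬ G.Adj (cond β w c) (φ none) := by
    rintro (_ | _)
    · exact (hc _ hN).2
    · exact (hw _ hN).2
  have hadS : ∀ β i γ, G.Adj (cond β w c) (φ (some (i, γ))) ↔ i = 0 ∧ β = γ := by
    intro β i γ
    by_cases hi : i = 0
    · subst hi
      cases β <;> cases γ <;> simpa [h₁', h₂']
    · refine iff_of_false ?_ (fun h => hi h.1)
      cases β
      · exact (hc _ (hS i γ hi)).2
      · exact (hw _ (hS i γ hi)).2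
  have hf : Function.Injective f := by
    rintro (_ | ⟨i, β⟩) (_ | ⟨j, γ⟩) h
    · rfl
    · induction j using Fin.cases with
      | zero => exact (hneq γ _ h.symm).elim
      | succ j => cases φ.injective h
    · induction i using Fin.cases with
      | zero => exact (hneq β _ h).elim
      | succ i => cases φ.injective h
    · induction i using Fin.cases with
      | zero =>
        induction j using Fin.cases with
        | zero =>
          cases β <;> cases γ
          · rfl
          · exact (hcw.ne h).elim
          · exact (hcw.ne h.symm).elim
          · rfl
        | succ j => exact (hneq β _ h).elim
      | succ i =>
        induction j using Fin.cases with
        | zero => exact (hneq γ _ h.symm).elim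
        | succ j =>
          have : some (i, β) = some (j, γ) := φ.injective h
          rw [Option.some.injEq, Prod.mk.injEq] at this
          rw [this.1, this.2]
  have hNs : ∀ i β, G.Adj (f none) (f (some (i, β))) ↔
      (buildingGraph (k + 1)).Adj none (some (i, β)) := by
    intro i β
    rw [buildingGraph_adj_none]
    induction i using Fin.cases with
    | zero => exact iff_of_false (fun h => hadN β h.symm) (Fin.last_pos.ne)
    | succ i =>
      rw [f0, f2, φ.map_adj_iff]
      refine (buildingGraph_adj_none k i β).trans ?_
      rw [← Fin.succ_last, Fin.succ_inj]
  have h0s : ∀ β i γ, G.Adj (f (some (0, β))) (f (some (Fin.succ i, γ))) ↔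
      (buildingGraph (k + 1)).Adj (some (0, β)) (some (Fin.succ i, γ)) := by
    intro β i γ
    rw [buildingGraph_adj_some, f1, f2, hadS, Fin.ext_iff]
    simp only [Fin.val_zero, Fin.val_succ, Fin.ext_iff]
    constructor
    · rintro ⟨h, rfl⟩
      exact Or.inl ⟨rfl, by omega⟩
    · rintro (⟨rfl, h⟩ | ⟨h, -⟩)
      · exact ⟨by omega, rfl⟩
      · omega
  have hadj : ∀ s s', G.Adj (f s) (f s') ↔ (buildingGraph (k + 1)).Adj s s' := by
    rintro (_ | ⟨i, β⟩) (_ | ⟨j, γ⟩)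
    · exact iff_of_false G.irrefl (buildingGraph (k + 1)).irrefl
    · exact hNs j γ
    · rw [G.adj_comm, (buildingGraph (k + 1)).adj_comm]
      exact hNs i β
    · induction i using Fin.cases with
      | zero =>
        induction j using Fin.cases with
        | zero =>
          rw [buildingGraph_adj_some, f1, f1]
          cases β <;> cases γ <;> simp [hcw, hcw.symm]
        | succ j => exact h0s β j γ
      | succ i =>
        induction j using Fin.cases with
        | zero =>
          rw [G.adj_comm, (buildingGraph (k + 1)).adj_comm]
          exact h0s γ i β
        | succ j =>
          rw [buildingGraph_adj_some, f2, f2, φ.map_adj_iff]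
          refine (buildingGraph_adj_some k i j β γ).trans ?_
          simp only [Fin.val_succ, Fin.succ_inj, Nat.add_right_cancel_iff]
  refine ⟨⟨⟨f, hf⟩, fun {a b} => hadj a b⟩, rfl, rfl, ?_⟩
  rintro (_ | ⟨i, β⟩) hp hq
  · exact Or.inl hN
  · induction i using Fin.cases with
    | zero =>
      cases β
      · exact (hp rfl).elim
      · exact (hq rfl).elim
    | succ i =>
      change φ (some (i, β)) ∈ S ∪ {e, e'}
      by_cases hi : i = 0
      · subst hi
        cases β
        · rw [h₁']; simp
        · rw [h₂']; simp
      · exact Or.inl (hS i β hi)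

/-! ### Roofs below two vertices of one level -/

/-- From each vertex of `U` one can step within `U` towards `x`. -/
def Descends (G : SimpleGraph V) (x : V) (U : Set V) : Prop :=
  ∀ u ∈ U, ∀ n, G.dist x u = n + 1 → ∃ u' ∈ U, G.Adj u u' ∧ G.dist x u' = n

theorem dist_le_of_adj (hc : G.Connected) {u v : V} (x : V) (h : G.Adj u v) :
    G.dist x v ≤ G.dist x u + 1 := by
  have := hc.dist_triangle (u := x) (v := u) (w := v)
  rwa [dist_eq_one_iff_adj.2 h] at this

theorem exists_adj_dist (hc : G.Connected) {x u : V} {n : ℕ} (h : G.dist x u = n + 1) :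
    ∃ u', G.Adj u u' ∧ G.dist x u' = n := by
  obtain ⟨p, hp⟩ := hc.exists_walk_length_eq_dist u x
  rw [dist_comm, h] at hp
  cases p with
  | nil => simp at hp
  | cons h' q =>
    refine ⟨_, h', ?_⟩
    have h₁ := dist_le q
    have h₂ := dist_le_of_adj hc x h'.symm
    rw [Walk.length_cons] at hp
    rw [dist_comm] at h₁
    omega

theorem descends_univ (hc : G.Connected) (x : V) : Descends G x Set.univ := by
  intro u _ n h
  obtain ⟨u', h₁, h₂⟩ := exists_adj_dist hc h
  exact ⟨u', trivial, h₁, h₂⟩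

theorem Descends.exists_walk (hc : G.Connected) {x : V} {U : Set V} (hU : Descends G x U) {n : ℕ}
    {u : V} (hu : u ∈ U) (h : G.dist x u = n) :
    ∃ p : G.Walk u x, ∀ e ∈ p.support, e = u ∨ (e ∈ U ∧ G.dist x e < n) := by
  induction n generalizing u with
  | zero =>
    obtain rfl : x = u := hc.dist_eq_zero_iff.1 h
    exact ⟨Walk.nil, by simp⟩
  | succ n ih =>
    obtain ⟨u', hu', hadj, hn⟩ := hU u hu n h
    obtain ⟨p, hp⟩ := ih hu' hn
    refine ⟨Walk.cons hadj p, fun e he => ?_⟩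
    rw [Walk.support_cons, List.mem_cons] at he
    rcases he with rfl | he
    · exact Or.inl rfl
    · rcases hp e he with rfl | ⟨h₁, h₂⟩
      · exact Or.inr ⟨hu', by omega⟩
      · exact Or.inr ⟨h₁, by omega⟩

/-- Two adjacent vertices of the same level above `x` carry a building, possibly without squares:
the squares found below them are stacked until some level contains a common neighbour. -/
theorem exists_building (hc : G.Connected) (h4 : IsKChordal 4 G) {x : V} {U : Set V}
    (hU : Descends G x U) {n : ℕ} {c w : V} (hcU : c ∈ U) (hwU : w ∈ U) (hcn : G.dist x c = n)
    (hwn : G.dist x w = n) (hcw : G.Adj c w) :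
    ∃ k, ArmOn G (building k) c w {u | u ∈ U ∧ G.dist x u < n} := by
  induction n generalizing c w with
  | zero =>
    obtain rfl : x = c := hc.dist_eq_zero_iff.1 hcn
    obtain rfl : x = w := hc.dist_eq_zero_iff.1 hwn
    exact (hcw.ne rfl).elim
  | succ n ih =>
    obtain ⟨c', hc'U, hcc', hc'n⟩ := hU c hcU n hcn
    obtain ⟨w', hw'U, hww', hw'n⟩ := hU w hwU n hwn
    obtain ⟨p, hp⟩ := hU.exists_walk hc hc'U hc'n
    obtain ⟨q, hq⟩ := hU.exists_walk hc hw'U hw'n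
    have hsup : ∀ e ∈ (p.append q.reverse).support, e ∈ U ∧ G.dist x e < n + 1 := by
      intro e he
      rw [Walk.mem_support_append_iff, Walk.support_reverse, List.mem_reverse] at he
      rcases he with he | he
      · rcases hp e he with rfl | h
        · exact ⟨hc'U, by omega⟩
        · exact ⟨h.1, by omega⟩
      · rcases hq e he with rfl | h
        · exact ⟨hw'U, by omega⟩
        · exact ⟨h.1, by omega⟩
    have key := exists_common_or_square h4 hcw (p.append q.reverse) hcc' hww'
      (fun h => by have := hsup _ h; omega) (fun h => by have := hsup _ h; omega)
    by_cases hcom : ∃ e ∈ (p.append q.reverse).support, G.Adj c e ∧ G.Adj w e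
    · obtain ⟨e, he, hce, hwe⟩ := hcom
      exact ⟨0, armOn_building_zero hcw hce.symm hwe.symm (hsup e he)⟩
    · obtain ⟨e, he, e', he', hee', hce, hwe'⟩ := key.resolve_left hcom
      push Not at hcom
      obtain ⟨heU, hen⟩ := hsup e he
      obtain ⟨he'U, he'n⟩ := hsup e' he'
      have h₁ := dist_le_of_adj hc x hce.symm
      have h₂ := dist_le_of_adj hc x hwe'.symm
      obtain ⟨k, hk⟩ := ih heU he'U (by omega) (by omega) hee'
      have hlow : ∀ v, G.dist x v = n + 1 → ∀ s ∈ {u | u ∈ U ∧ G.dist x u < n},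
          v ≠ s ∧ ¬ G.Adj v s := by
        rintro v hv s ⟨-, hs⟩
        refine ⟨fun h => ?_, fun h => ?_⟩
        · subst h
          omega
        · have := dist_le_of_adj hc x h.symm
          omega
      refine ⟨k + 1, (hk.building_succ hcw hce hwe' (fun h => hcom e' he' h hwe')
        (fun h => hcom e he hce h) ?_ ?_ (hlow c hcn) (hlow w hwn)).mono ?_⟩
      · rintro rfl
        omega
      · rintro rfl
        omega
      · rintro s (⟨h, h'⟩ | rfl | rfl)
        · exact ⟨h, by omega⟩
        · exact ⟨heU, by omega⟩
        · exact ⟨he'U, by omega⟩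

/-- Two vertices of the same level above `x` with a common neighbour which is not below them carry
an arm that descends towards `x`. -/
theorem exists_roof (hc : G.Connected) (h4 : IsKChordal 4 G) {x : V} {U : Set V}
    (hU : Descends G x U) {n : ℕ} {c w t : V} (hcU : c ∈ U) (hwU : w ∈ U) (hcn : G.dist x c = n)
    (hwn : G.dist x w = n) (hcw : c ≠ w) (htc : G.Adj t c) (htw : G.Adj t w)
    (ht : n < G.dist x t) :
    ∃ A, IsRoof A ∧ ArmOn G A c w {u | u ∈ U ∧ G.dist x u < n} := by
  by_cases hadj : G.Adj c w
  · obtain ⟨k, hk⟩ := exists_building hc h4 hU hcU hwU hcn hwn hadj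
    rcases k with _ | k
    · rw [armOn_building] at hk
      obtain ⟨φ, h₁, h₂, h₃⟩ := hk
      refine ⟨dottedArm true, Or.inl ⟨_, rfl⟩, armOn_dottedArm (u := φ none) hcw ?_ ?_ (by simpa)
        (h₃ none (by rintro ⟨⟩) (by rintro ⟨⟩))⟩
      · rw [← h₁, φ.map_adj_iff]
        exact (buildingGraph_adj_none 0 0 false).2 rfl
      · rw [← h₂, φ.map_adj_iff]
        exact (buildingGraph_adj_none 0 0 true).2 rfl
    · exact ⟨_, Or.inr ⟨k, rfl⟩, hk⟩
  · have hn : n ≠ 0 := by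
      rintro rfl
      obtain rfl : x = c := hc.dist_eq_zero_iff.1 hcn
      exact hcw (hc.dist_eq_zero_iff.1 hwn)
    obtain ⟨m, rfl⟩ := Nat.exists_eq_succ_of_ne_zero hn
    obtain ⟨c', hc'U, hcc', hc'n⟩ := hU c hcU m hcn
    obtain ⟨p, hp⟩ := hU.exists_walk hc hc'U hc'n
    obtain ⟨q, hq⟩ := hU.exists_walk hc hwU hwn
    -- The edge `tc` and the detour from `w` down to `x` and up to a neighbour of `c`.
    have hsup : ∀ e ∈ (q.append p.reverse).support, e = w ∨ (e ∈ U ∧ G.dist x e < m + 1) := by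
      intro e he
      rw [Walk.mem_support_append_iff, Walk.support_reverse, List.mem_reverse] at he
      rcases he with he | he
      · exact hq e he
      · rcases hp e he with rfl | h
        · exact Or.inr ⟨hc'U, by omega⟩
        · exact Or.inr ⟨h.1, by omega⟩
    have htop : ∀ e ∈ (q.append p.reverse).support, G.Adj t e → e = w := by
      intro e he hte
      rcases hsup e he with rfl | h
      · rfl
      · have := dist_le_of_adj hc x hte.symm
        omega
    rcases exists_common_or_square h4 htc (q.append p.reverse) htw hcc'
      (fun h => by
        rcases hsup _ h with rfl | h
        · omega
        · omega)
      (fun h => by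
        rcases hsup _ h with h | h
        · exact hcw h
        · omega) with ⟨e, he, hte, hce⟩ | ⟨e, he, e', he', hee', hte, hce'⟩
    · obtain rfl := htop e he hte
      exact (hadj hce).elim
    · obtain rfl := htop e he hte
      rcases hsup e' he' with rfl | h
      · exact (hee'.ne rfl).elim
      · exact ⟨dottedArm false, Or.inl ⟨_, rfl⟩,
          armOn_dottedArm hcw hce'.symm hee'.symm (by simpa) h⟩

/-! ### Adjacency in the forbidden graphs -/

section TwoArms

variable (A B : Arm)

theorem twoArms_adj_AA (s s' : A.V) :
    (twoArms A B).Adj (.inl (.inl s)) (.inl (.inl s')) ↔ A.graph.Adj s s' := by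
  simp [twoArms]

theorem twoArms_adj_BB (s s' : B.V) :
    (twoArms A B).Adj (.inl (.inr s)) (.inl (.inr s')) ↔ B.graph.Adj s s' := by
  simp [twoArms]

theorem twoArms_adj_AB (s : A.V) (s' : B.V) :
    ¬ (twoArms A B).Adj (.inl (.inl s)) (.inl (.inr s')) := by
  simp [twoArms]

theorem twoArms_adj_aA (s : A.V) :
    (twoArms A B).Adj (.inr 0) (.inl (.inl s)) ↔ s = A.p := by
  simp [twoArms]

theorem twoArms_adj_aB (s : B.V) :
    (twoArms A B).Adj (.inr 0) (.inl (.inr s)) ↔ s = B.p := by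
  simp [twoArms]

theorem twoArms_adj_tA (s : A.V) :
    (twoArms A B).Adj (.inr 1) (.inl (.inl s)) ↔ s = A.p ∨ s = A.q := by
  simp [twoArms]

theorem twoArms_adj_tB (s : B.V) :
    (twoArms A B).Adj (.inr 1) (.inl (.inr s)) ↔ s = B.p ∨ s = B.q := by
  simp [twoArms]

theorem twoArms_adj_rr (i j : Fin 2) : ¬ (twoArms A B).Adj (.inr i) (.inr j) := by
  simp [twoArms]

end TwoArms

section ThreeArms

variable (A B C : Arm)

theorem threeArms_adj_AA (s s' : A.V) :
    (threeArms A B C).Adj (.inl (.inl s)) (.inl (.inl s')) ↔ A.graph.Adj s s' := by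
  simp [threeArms]

theorem threeArms_adj_BB (s s' : B.V) :
    (threeArms A B C).Adj (.inl (.inr s)) (.inl (.inr s')) ↔ B.graph.Adj s s' := by
  simp [threeArms]

theorem threeArms_adj_CC (s s' : C.V) :
    (threeArms A B C).Adj (.inr (.inl s)) (.inr (.inl s')) ↔ C.graph.Adj s s' := by
  simp [threeArms]

theorem threeArms_adj_AB (s : A.V) (s' : B.V) :
    ¬ (threeArms A B C).Adj (.inl (.inl s)) (.inl (.inr s')) := by
  simp [threeArms]

theorem threeArms_adj_aA (s : A.V) :
    (threeArms A B C).Adj (.inr (.inr ())) (.inl (.inl s)) ↔ s = A.p := by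
  simp [threeArms]

theorem threeArms_adj_aB (s : B.V) :
    (threeArms A B C).Adj (.inr (.inr ())) (.inl (.inr s)) ↔ s = B.p := by
  simp [threeArms]

theorem threeArms_adj_aC (s : C.V) :
    ¬ (threeArms A B C).Adj (.inr (.inr ())) (.inr (.inl s)) := by
  simp [threeArms]

theorem threeArms_adj_CA (s : C.V) (s' : A.V) :
    (threeArms A B C).Adj (.inr (.inl s)) (.inl (.inl s')) ↔
      (s' = A.p ∧ (s = C.p ∨ s = C.q)) ∨ (s' = A.q ∧ s = C.p) := by
  simp [threeArms]
  tauto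

theorem threeArms_adj_CB (s : C.V) (s' : B.V) :
    (threeArms A B C).Adj (.inr (.inl s)) (.inl (.inr s')) ↔
      (s' = B.p ∧ (s = C.p ∨ s = C.q)) ∨ (s' = B.q ∧ s = C.q) := by
  simp [threeArms]
  tauto

end ThreeArms

/-! ### Assembling forbidden graphs from their arms -/

/-- Distinct and not adjacent. -/
def Apart (G : SimpleGraph V) (u v : V) : Prop :=
  u ≠ v ∧ ¬ G.Adj u v

theorem Apart.symm {u v : V} (h : Apart G u v) : Apart G v u :=
  ⟨h.1.symm, fun h' => h.2 h'.symm⟩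

theorem ArmOn.cases {A : Arm} {c w : V} {φ : A.graph ↪g G} {S : Set V} (hp : φ A.p = c)
    (hq : φ A.q = w) (hS : ∀ s, s ≠ A.p → s ≠ A.q → φ s ∈ S) (s : A.V) :
    (s = A.p ∧ φ s = c) ∨ (s = A.q ∧ φ s = w) ∨ (s ≠ A.p ∧ s ≠ A.q ∧ φ s ∈ S) := by
  by_cases h₁ : s = A.p
  · exact Or.inl ⟨h₁, h₁ ▸ hp⟩
  by_cases h₂ : s = A.q
  · exact Or.inr (Or.inl ⟨h₂, h₂ ▸ hq⟩)
  · exact Or.inr (Or.inr ⟨h₁, h₂, hS s h₁ h₂⟩)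

theorem twoArms_isIndContained {A B : Arm} {a t c w b v : V} {S T : Set V}
    (hA : ArmOn G A c w S) (hB : ArmOn G B b v T) (hcw : c ≠ w) (hbv : b ≠ v)
    (hac : G.Adj a c) (hab : G.Adj a b) (htc : G.Adj t c) (htb : G.Adj t b) (htw : G.Adj t w)
    (htv : G.Adj t v) (hat : Apart G a t) (haw : Apart G a w) (hav : Apart G a v)
    (hS : ∀ s ∈ S, Apart G a s ∧ Apart G t s) (hT : ∀ s ∈ T, Apart G a s ∧ Apart G t s)
    (hST : ∀ s, (s = c ∨ s = w ∨ s ∈ S) → ∀ s', (s' = b ∨ s' = v ∨ s' ∈ T) → Apart G s s') :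
    twoArms A B ⊴ G := by
  obtain ⟨φ, hφp, hφq, hφ⟩ := hA
  obtain ⟨ψ, hψp, hψq, hψ⟩ := hB
  have hpqA : A.p ≠ A.q := fun h => hcw (by rw [← hφp, ← hφq, h])
  have hpqB : B.p ≠ B.q := fun h => hbv (by rw [← hψp, ← hψq, h])
  have haA : ∀ s, a ≠ φ s ∧ (G.Adj a (φ s) ↔ s = A.p) := by
    intro s
    rcases ArmOn.cases hφp hφq hφ s with ⟨h, e⟩ | ⟨h, e⟩ | ⟨h, -, e⟩
    · rw [e]; exact ⟨hac.ne, iff_of_true hac h⟩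
    · rw [e]; exact ⟨haw.1, iff_of_false haw.2 (h ▸ hpqA.symm)⟩
    · exact ⟨(hS _ e).1.1, iff_of_false (hS _ e).1.2 h⟩
  have haB : ∀ s, a ≠ ψ s ∧ (G.Adj a (ψ s) ↔ s = B.p) := by
    intro s
    rcases ArmOn.cases hψp hψq hψ s with ⟨h, e⟩ | ⟨h, e⟩ | ⟨h, -, e⟩
    · rw [e]; exact ⟨hab.ne, iff_of_true hab h⟩
    · rw [e]; exact ⟨hav.1, iff_of_false hav.2 (h ▸ hpqB.symm)⟩
    · exact ⟨(hT _ e).1.1, iff_of_false (hT _ e).1.2 h⟩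
  have htA : ∀ s, t ≠ φ s ∧ (G.Adj t (φ s) ↔ s = A.p ∨ s = A.q) := by
    intro s
    rcases ArmOn.cases hφp hφq hφ s with ⟨h, e⟩ | ⟨h, e⟩ | ⟨h, h', e⟩
    · rw [e]; exact ⟨htc.ne, iff_of_true htc (Or.inl h)⟩
    · rw [e]; exact ⟨htw.ne, iff_of_true htw (Or.inr h)⟩
    · exact ⟨(hS _ e).2.1, iff_of_false (hS _ e).2.2 (by tauto)⟩
  have htB : ∀ s, t ≠ ψ s ∧ (G.Adj t (ψ s) ↔ s = B.p ∨ s = B.q) := by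
    intro s
    rcases ArmOn.cases hψp hψq hψ s with ⟨h, e⟩ | ⟨h, e⟩ | ⟨h, h', e⟩
    · rw [e]; exact ⟨htb.ne, iff_of_true htb (Or.inl h)⟩
    · rw [e]; exact ⟨htv.ne, iff_of_true htv (Or.inr h)⟩
    · exact ⟨(hT _ e).2.1, iff_of_false (hT _ e).2.2 (by tauto)⟩
  have hAB : ∀ s s', Apart G (φ s) (ψ s') := by
    intro s s'
    have h₁ := ArmOn.cases hφp hφq hφ s
    have h₂ := ArmOn.cases hψp hψq hψ s'
    exact hST _ (by tauto) _ (by tauto)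
  let f : (A.V ⊕ B.V) ⊕ Fin 2 → V := Sum.elim (Sum.elim φ ψ) ![a, t]
  have hne : ∀ i s, f (.inr i) ≠ f (.inl s) := by
    intro i s
    fin_cases i <;> rcases s with s | s
    · exact (haA s).1
    · exact (haB s).1
    · exact (htA s).1
    · exact (htB s).1
  have hf : Function.Injective f := by
    rintro ((s | s) | i) ((s' | s') | j) h
    · rw [φ.injective h]
    · exact ((hAB s s').1 h).elim
    · exact (hne _ _ h.symm).elim
    · exact ((hAB s' s).1 h.symm).elim
    · rw [ψ.injective h]
    · exact (hne _ _ h.symm).elim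
    · exact (hne _ _ h).elim
    · exact (hne _ _ h).elim
    · fin_cases i <;> fin_cases j
      · rfl
      · exact (hat.1 h).elim
      · exact (hat.1 h.symm).elim
      · rfl
  have hrs : ∀ i s, G.Adj (f (.inr i)) (f (.inl s)) ↔ (twoArms A B).Adj (.inr i) (.inl s) := by
    intro i s
    fin_cases i <;> rcases s with s | s
    · exact (haA s).2.trans (twoArms_adj_aA A B s).symm
    · exact (haB s).2.trans (twoArms_adj_aB A B s).symm
    · exact (htA s).2.trans (twoArms_adj_tA A B s).symm
    · exact (htB s).2.trans (twoArms_adj_tB A B s).symm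
  have hadj : ∀ s s', G.Adj (f s) (f s') ↔ (twoArms A B).Adj s s' := by
    rintro (s | i) (s' | j)
    · rcases s with s | s <;> rcases s' with s' | s'
      · exact φ.map_adj_iff.trans (twoArms_adj_AA A B s s').symm
      · exact iff_of_false (hAB s s').2 (twoArms_adj_AB A B s s')
      · exact iff_of_false (hAB s' s).symm.2 fun h => twoArms_adj_AB A B s' s h.symm
      · exact ψ.map_adj_iff.trans (twoArms_adj_BB A B s s').symm
    · rw [G.adj_comm, (twoArms A B).adj_comm]
      exact hrs j s
    · exact hrs i s'
    · refine iff_of_false ?_ (twoArms_adj_rr A B i j)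
      fin_cases i <;> fin_cases j
      · exact G.irrefl
      · exact hat.2
      · exact hat.symm.2
      · exact G.irrefl
  exact ⟨⟨⟨f, hf⟩, fun {s s'} => hadj s s'⟩⟩

theorem threeArms_isIndContained {A B C : Arm} {a t t' c w b v : V} {S T U : Set V}
    (hA : ArmOn G A c w S) (hB : ArmOn G B b v T) (hC : ArmOn G C t t' U)
    (hcw : c ≠ w) (hbv : b ≠ v) (htt : t ≠ t')
    (hac : G.Adj a c) (hab : G.Adj a b) (htc : G.Adj t c) (htb : G.Adj t b) (htc' : G.Adj t' c)
    (htb' : G.Adj t' b) (htw : G.Adj t w) (htv : G.Adj t' v)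
    (hat : Apart G a t) (hat' : Apart G a t') (haw : Apart G a w) (hav : Apart G a v)
    (htv' : Apart G t v) (htw' : Apart G t' w)
    (hS : ∀ s ∈ S, Apart G a s ∧ Apart G t s ∧ Apart G t' s)
    (hT : ∀ s ∈ T, Apart G a s ∧ Apart G t s ∧ Apart G t' s)
    (hU : ∀ s ∈ U, Apart G a s)
    (hST : ∀ s, (s = c ∨ s = w ∨ s ∈ S) → ∀ s', (s' = b ∨ s' = v ∨ s' ∈ T) → Apart G s s')
    (hUS : ∀ s ∈ U, ∀ s', (s' = c ∨ s' = w ∨ s' ∈ S) → Apart G s s')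
    (hUT : ∀ s ∈ U, ∀ s', (s' = b ∨ s' = v ∨ s' ∈ T) → Apart G s s') :
    threeArms A B C ⊴ G := by
  obtain ⟨φ, hφp, hφq, hφ⟩ := hA
  obtain ⟨ψ, hψp, hψq, hψ⟩ := hB
  obtain ⟨χ, hχp, hχq, hχ⟩ := hC
  have hpqA : A.p ≠ A.q := fun h => hcw (by rw [← hφp, ← hφq, h])
  have hpqB : B.p ≠ B.q := fun h => hbv (by rw [← hψp, ← hψq, h])
  have hpqC : C.p ≠ C.q := fun h => htt (by rw [← hχp, ← hχq, h])
  have haA : ∀ s, a ≠ φ s ∧ (G.Adj a (φ s) ↔ s = A.p) := by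
    intro s
    rcases ArmOn.cases hφp hφq hφ s with ⟨h, e⟩ | ⟨h, e⟩ | ⟨h, -, e⟩
    · rw [e]; exact ⟨hac.ne, iff_of_true hac h⟩
    · rw [e]; exact ⟨haw.1, iff_of_false haw.2 (h ▸ hpqA.symm)⟩
    · exact ⟨(hS _ e).1.1, iff_of_false (hS _ e).1.2 h⟩
  have haB : ∀ s, a ≠ ψ s ∧ (G.Adj a (ψ s) ↔ s = B.p) := by
    intro s
    rcases ArmOn.cases hψp hψq hψ s with ⟨h, e⟩ | ⟨h, e⟩ | ⟨h, -, e⟩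
    · rw [e]; exact ⟨hab.ne, iff_of_true hab h⟩
    · rw [e]; exact ⟨hav.1, iff_of_false hav.2 (h ▸ hpqB.symm)⟩
    · exact ⟨(hT _ e).1.1, iff_of_false (hT _ e).1.2 h⟩
  have haC : ∀ s, Apart G a (χ s) := by
    intro s
    rcases ArmOn.cases hχp hχq hχ s with ⟨h, e⟩ | ⟨h, e⟩ | ⟨h, -, e⟩
    · rw [e]; exact hat
    · rw [e]; exact hat'
    · exact hU _ e
  have hCA : ∀ s s', χ s ≠ φ s' ∧ (G.Adj (χ s) (φ s') ↔
      (s' = A.p ∧ (s = C.p ∨ s = C.q)) ∨ (s' = A.q ∧ s = C.p)) := by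
    intro s s'
    rcases ArmOn.cases hφp hφq hφ s' with ⟨h, e⟩ | ⟨h, e⟩ | ⟨h, h', e⟩ <;>
      rcases ArmOn.cases hχp hχq hχ s with ⟨k, l⟩ | ⟨k, l⟩ | ⟨k, k', l⟩
    · rw [e, l]; exact ⟨htc.ne, iff_of_true htc (Or.inl ⟨h, Or.inl k⟩)⟩
    · rw [e, l]; exact ⟨htc'.ne, iff_of_true htc' (Or.inl ⟨h, Or.inr k⟩)⟩
    · have := hUS _ l (φ s') (Or.inl e)
      exact ⟨this.1, iff_of_false this.2 (by tauto)⟩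
    · rw [e, l]; exact ⟨htw.ne, iff_of_true htw (Or.inr ⟨h, k⟩)⟩
    · rw [e, l]
      refine ⟨htw'.1, iff_of_false htw'.2 ?_⟩
      rintro (⟨r, -⟩ | ⟨-, r⟩)
      · exact hpqA (r.symm.trans h)
      · exact hpqC (r.symm.trans k)
    · have := hUS _ l (φ s') (Or.inr (Or.inl e))
      exact ⟨this.1, iff_of_false this.2 (by tauto)⟩
    · have := hS _ e
      rw [l]; exact ⟨this.2.1.1, iff_of_false this.2.1.2 (by tauto)⟩
    · have := hS _ e
      rw [l]; exact ⟨this.2.2.1, iff_of_false this.2.2.2 (by tauto)⟩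
    · have := hUS _ l _ (Or.inr (Or.inr e))
      exact ⟨this.1, iff_of_false this.2 (by tauto)⟩
  have hCB : ∀ s s', χ s ≠ ψ s' ∧ (G.Adj (χ s) (ψ s') ↔
      (s' = B.p ∧ (s = C.p ∨ s = C.q)) ∨ (s' = B.q ∧ s = C.q)) := by
    intro s s'
    rcases ArmOn.cases hψp hψq hψ s' with ⟨h, e⟩ | ⟨h, e⟩ | ⟨h, h', e⟩ <;>
      rcases ArmOn.cases hχp hχq hχ s with ⟨k, l⟩ | ⟨k, l⟩ | ⟨k, k', l⟩
    · rw [e, l]; exact ⟨htb.ne, iff_of_true htb (Or.inl ⟨h, Or.inl k⟩)⟩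
    · rw [e, l]; exact ⟨htb'.ne, iff_of_true htb' (Or.inl ⟨h, Or.inr k⟩)⟩
    · have := hUT _ l (ψ s') (Or.inl e)
      exact ⟨this.1, iff_of_false this.2 (by tauto)⟩
    · rw [e, l]
      refine ⟨htv'.1, iff_of_false htv'.2 ?_⟩
      rintro (⟨r, -⟩ | ⟨-, r⟩)
      · exact hpqB (r.symm.trans h)
      · exact hpqC (k.symm.trans r)
    · rw [e, l]; exact ⟨htv.ne, iff_of_true htv (Or.inr ⟨h, k⟩)⟩
    · have := hUT _ l (ψ s') (Or.inr (Or.inl e))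
      exact ⟨this.1, iff_of_false this.2 (by tauto)⟩
    · have := hT _ e
      rw [l]; exact ⟨this.2.1.1, iff_of_false this.2.1.2 (by tauto)⟩
    · have := hT _ e
      rw [l]; exact ⟨this.2.2.1, iff_of_false this.2.2.2 (by tauto)⟩
    · have := hUT _ l _ (Or.inr (Or.inr e))
      exact ⟨this.1, iff_of_false this.2 (by tauto)⟩
  have hAB : ∀ s s', Apart G (φ s) (ψ s') := by
    intro s s'
    have h₁ := ArmOn.cases hφp hφq hφ s
    have h₂ := ArmOn.cases hψp hψq hψ s'
    exact hST _ (by tauto) _ (by tauto)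
  let f : (A.V ⊕ B.V) ⊕ (C.V ⊕ Unit) → V := Sum.elim (Sum.elim φ ψ) (Sum.elim χ fun _ => a)
  have hrl : ∀ r s, f (.inr r) ≠ f (.inl s) ∧
      (G.Adj (f (.inr r)) (f (.inl s)) ↔ (threeArms A B C).Adj (.inr r) (.inl s)) := by
    rintro (r | ⟨⟩) (s | s)
    · exact ⟨(hCA r s).1, (hCA r s).2.trans (threeArms_adj_CA A B C r s).symm⟩
    · exact ⟨(hCB r s).1, (hCB r s).2.trans (threeArms_adj_CB A B C r s).symm⟩
    · exact ⟨(haA s).1, (haA s).2.trans (threeArms_adj_aA A B C s).symm⟩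
    · exact ⟨(haB s).1, (haB s).2.trans (threeArms_adj_aB A B C s).symm⟩
  have hf : Function.Injective f := by
    rintro ((s | s) | (s | ⟨⟩)) ((s' | s') | (s' | ⟨⟩)) h
    · rw [φ.injective h]
    · exact ((hAB s s').1 h).elim
    · exact ((hrl _ _).1 h.symm).elim
    · exact ((hrl _ _).1 h.symm).elim
    · exact ((hAB s' s).1 h.symm).elim
    · rw [ψ.injective h]
    · exact ((hrl _ _).1 h.symm).elim
    · exact ((hrl _ _).1 h.symm).elim
    · exact ((hrl _ _).1 h).elim
    · exact ((hrl _ _).1 h).elim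
    · rw [χ.injective h]
    · exact ((haC s).1 h.symm).elim
    · exact ((hrl _ _).1 h).elim
    · exact ((hrl _ _).1 h).elim
    · exact ((haC s').1 h).elim
    · rfl
  have hadj : ∀ s s', G.Adj (f s) (f s') ↔ (threeArms A B C).Adj s s' := by
    rintro (s | s) (s' | s')
    · rcases s with s | s <;> rcases s' with s' | s'
      · exact φ.map_adj_iff.trans (threeArms_adj_AA A B C s s').symm
      · exact iff_of_false (hAB s s').2 (threeArms_adj_AB A B C s s')
      · exact iff_of_false (hAB s' s).symm.2 fun h => threeArms_adj_AB A B C s' s h.symm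
      · exact ψ.map_adj_iff.trans (threeArms_adj_BB A B C s s').symm
    · rw [G.adj_comm, (threeArms A B C).adj_comm]
      exact (hrl s' s).2
    · exact (hrl s s').2
    · rcases s with s | ⟨⟩ <;> rcases s' with s' | ⟨⟩
      · exact χ.map_adj_iff.trans (threeArms_adj_CC A B C s s').symm
      · exact iff_of_false (haC s).symm.2 fun h => threeArms_adj_aC A B C s h.symm
      · exact iff_of_false (haC s').2 (threeArms_adj_aC A B C s')
      · exact iff_of_false G.irrefl (threeArms A B C).irrefl
  exact ⟨⟨⟨f, hf⟩, fun {s s'} => hadj s s'⟩⟩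

/-- Some forbidden graph is an induced subgraph of `G`. -/
def HasForbidden (G : SimpleGraph V) : Prop :=
  ∃ (W : Type) (H : SimpleGraph W), Forbidden H ∧ H ⊴ G

/-! ### Distances along shortest paths -/

theorem dist_le_add (hc : G.Connected) (x y u : V) : G.dist x y ≤ G.dist x u + G.dist y u := by
  have := hc.dist_triangle (u := x) (v := u) (w := y)
  rwa [dist_comm (u := u)] at this

theorem apart_of_dist_lt (hc : G.Connected) (x : V) {u v : V} (h : G.dist x u + 1 < G.dist x v) :
    Apart G u v := by
  refine ⟨?_, fun h' => ?_⟩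
  · rintro rfl
    omega
  · have := dist_le_of_adj hc x h'
    omega

theorem IsShortest.dist_getVert (hc : G.Connected) {x z : V} {q : G.Walk x z} (hq : IsShortest q)
    {k : ℕ} (hk : k ≤ q.length) : G.dist x (q.getVert k) = k := by
  have h₁ := dist_le (q.take k)
  have h₂ := dist_le (q.drop k)
  have h₃ := hc.dist_triangle (u := x) (v := q.getVert k) (w := z)
  have h₄ : q.length = G.dist x z := hq
  rw [Walk.take_length] at h₁
  rw [Walk.drop_length] at h₂
  omega

theorem IsShortest.reverse {x z : V} {q : G.Walk x z} (hq : IsShortest q) :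
    IsShortest q.reverse := by
  have h₄ : q.length = G.dist x z := hq
  change q.reverse.length = G.dist z x
  rw [Walk.length_reverse, h₄, dist_comm]

theorem IsShortest.dist_add_dist (hc : G.Connected) {x z u : V} {q : G.Walk x z}
    (hq : IsShortest q) (hu : u ∈ q.support) : G.dist x u + G.dist z u = G.dist x z := by
  obtain ⟨k, rfl, hk⟩ := Walk.mem_support_iff_exists_getVert.1 hu
  have h₁ := hq.dist_getVert hc hk
  have h₂ := dist_le (q.drop k)
  have h₃ := dist_le_add hc x z (q.getVert k)
  have h₄ : q.length = G.dist x z := hq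
  rw [Walk.drop_length, dist_comm] at h₂
  omega

theorem IsShortest.descends (hc : G.Connected) {x z : V} {q : G.Walk x z} (hq : IsShortest q) :
    Descends G x {u | u ∈ q.support} := by
  intro u hu n hn
  obtain ⟨k, rfl, hk⟩ := Walk.mem_support_iff_exists_getVert.1 hu
  rw [hq.dist_getVert hc hk] at hn
  subst hn
  exact ⟨q.getVert n, q.getVert_mem_support n, (q.adj_getVert_succ (by omega)).symm,
    hq.dist_getVert hc (by omega)⟩

theorem Descends.union {x : V} {S T : Set V} (hS : Descends G x S) (hT : Descends G x T) :
    Descends G x (S ∪ T) := by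
  rintro u (hu | hu) n hn
  · obtain ⟨u', h, h'⟩ := hS u hu n hn
    exact ⟨u', Or.inl h, h'⟩
  · obtain ⟨u', h, h'⟩ := hT u hu n hn
    exact ⟨u', Or.inr h, h'⟩

theorem IsShortest.exists_tail (hc : G.Connected) {x z t : V} {q : G.Walk x z}
    (hq : IsShortest q) (ht : t ∈ q.support) (htz : t ≠ z) :
    ∃ (v : V) (p : G.Walk v z), G.Adj t v ∧
      ∀ u ∈ p.support, u ∈ q.support ∧ G.dist x t < G.dist x u := by
  obtain ⟨k, rfl, hk⟩ := Walk.mem_support_iff_exists_getVert.1 ht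
  have hk' : k < q.length := by
    refine lt_of_le_of_ne hk ?_
    rintro rfl
    exact htz q.getVert_length
  refine ⟨_, q.drop (k + 1), q.adj_getVert_succ hk', fun u hu => ?_⟩
  obtain ⟨l, rfl, hl⟩ := Walk.mem_support_iff_exists_getVert.1 hu
  rw [Walk.drop_length] at hl
  rw [Walk.drop_getVert]
  refine ⟨q.getVert_mem_support _, ?_⟩
  rw [hq.dist_getVert hc hk, hq.dist_getVert hc (by omega)]
  omega

theorem exists_last_neighbor {t v y : V} (p : G.Walk v y) (hy : ¬ G.Adj t y) :
    (∀ u ∈ p.support, ¬ G.Adj t u) ∨ ∃ (v' v'' : V) (q : G.Walk v'' y), v' ∈ p.support ∧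
      G.Adj t v' ∧ G.Adj v' v'' ∧ q.support ⊆ p.support ∧ ∀ u ∈ q.support, ¬ G.Adj t u := by
  induction p with
  | nil => exact Or.inl (by simpa using hy)
  | @cons v v₁ y h p ih =>
    rcases ih hy with ih | ⟨v', v'', q, h₁, h₂, h₃, h₄, h₅⟩
    · by_cases hv : G.Adj t v
      · refine Or.inr ⟨v, v₁, p, by simp, hv, h, ?_, ih⟩
        rw [Walk.support_cons]
        exact List.subset_cons_self _ _
      · refine Or.inl fun u hu => ?_
        rw [Walk.support_cons, List.mem_cons] at hu
        rcases hu with rfl | hu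
        · exact hv
        · exact ih u hu
    · refine Or.inr ⟨v', v'', q, ?_, h₂, h₃, fun u hu => ?_, h₅⟩
      · rw [Walk.support_cons]
        exact List.mem_cons_of_mem _ h₁
      · rw [Walk.support_cons]
        exact List.mem_cons_of_mem _ (h₄ hu)

/-! ### Two-armed graphs -/

theorem armOn_squareArm {b v e e' : V} {S : Set V} (hbv : G.Adj b v) (hbe : G.Adj b e)
    (hve : G.Adj v e') (hee : G.Adj e e') (hbe' : Apart G b e') (hve' : Apart G v e) (he : e ∈ S)
    (he' : e' ∈ S) : ArmOn G squareArm b v S := by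
  let f : Fin 2 × Bool → V := fun s => ![cond s.2 v b, cond s.2 e' e] s.1
  have h0 : ∀ β, f (0, β) = cond β v b := fun β => rfl
  have h1 : ∀ β, f (1, β) = cond β e' e := fun β => rfl
  have key : ∀ i j β γ, (i, β) ≠ (j, γ) → f (i, β) ≠ f (j, γ) ∧
      (G.Adj (f (i, β)) (f (j, γ)) ↔ (ladder 1).Adj (i, β) (j, γ)) := by
    intro i j β γ hne
    rw [ladder_adj]
    fin_cases i <;> fin_cases j <;> cases β <;> cases γ <;> simp at hne ⊢ <;>
      simp [h0, h1, hbv, hbv.symm, hbv.ne, hbv.ne', hbe, hbe.symm, hbe.ne, hbe.ne', hve, hve.symm,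
        hve.ne, hve.ne', hee, hee.symm, hee.ne, hee.ne', hbe'.1, hbe'.2, hbe'.symm.1, hbe'.symm.2,
        hve'.1, hve'.2, hve'.symm.1, hve'.symm.2]
  have hf : Function.Injective f := by
    rintro ⟨i, β⟩ ⟨j, γ⟩ h
    by_contra hne
    exact (key i j β γ hne).1 h
  have hadj : ∀ s s', G.Adj (f s) (f s') ↔ (ladder 1).Adj s s' := by
    rintro ⟨i, β⟩ ⟨j, γ⟩
    by_cases hne : (i, β) = (j, γ)
    · rw [hne]
      exact iff_of_false G.irrefl (ladder 1).irrefl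
    · exact (key i j β γ hne).2
  refine ⟨⟨⟨f, hf⟩, fun {s s'} => hadj s s'⟩, rfl, rfl, ?_⟩
  rintro ⟨i, β⟩ hp hq
  fin_cases i <;> cases β
  · exact (hp rfl).elim
  · exact (hq rfl).elim
  · exact he
  · exact he'

/-- A vertex `t` adjacent to `b` sees the walk `p`, whose end is joined to a neighbour of `b` by a
walk `r` that `t` does not see (seeing means being adjacent to a vertex). Then the last vertex `v`
of `p` seen by `t` carries, together with `b`, a dotted arm or a square. -/
theorem exists_dotted_or_square (h4 : IsKChordal 4 G) {t b v₀ b₂ y : V} (p : G.Walk v₀ y)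
    (r : G.Walk b₂ y) (htb : G.Adj t b) (htv : G.Adj t v₀) (hbb : G.Adj b b₂)
    (hr : ∀ u ∈ r.support, ¬ G.Adj t u) (hbp : b ∉ p.support) (hbr : b ∉ r.support)
    (htp : t ∉ p.support) (htr : t ∉ r.support) :
    ∃ v ∈ p.support, G.Adj t v ∧ ∃ B, ((∃ e, B = dottedArm e) ∨ B = squareArm) ∧
      ArmOn G B b v {u | (u ∈ p.support ∨ u ∈ r.support) ∧ ¬ G.Adj t u} := by
  obtain ⟨v, v', q, hvp, htv, hvv, hqp, hq⟩ :=
    (exists_last_neighbor p (hr y r.end_mem_support)).resolve_left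
      fun h => h v₀ p.start_mem_support htv
  have hbv : b ≠ v := fun h => hbp (h ▸ hvp)
  have hsup : ∀ u ∈ (q.append r.reverse).support,
      (u ∈ p.support ∨ u ∈ r.support) ∧ ¬ G.Adj t u := by
    intro u hu
    rw [Walk.mem_support_append_iff, Walk.support_reverse, List.mem_reverse] at hu
    rcases hu with hu | hu
    · exact ⟨Or.inl (hqp hu), hq u hu⟩
    · exact ⟨Or.inr hu, hr u hu⟩
  have hb : b ∉ (q.append r.reverse).support := fun h => (hsup b h).1.elim hbp hbr
  refine ⟨v, hvp, htv, ?_⟩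
  by_cases hadj : G.Adj b v
  · have key := exists_common_or_square h4 hadj.symm (q.append r.reverse) hvv hbb
      (fun h => (hsup v h).2 htv) hb
    by_cases hcom : ∃ e ∈ (q.append r.reverse).support, G.Adj v e ∧ G.Adj b e
    · obtain ⟨e, he, hve, hbe⟩ := hcom
      exact ⟨_, Or.inl ⟨true, rfl⟩, armOn_dottedArm hbv hbe.symm hve.symm (by simpa) (hsup e he)⟩
    · obtain ⟨e, he, e', he', hee, hve, hbe⟩ := key.resolve_left hcom
      push Not at hcom
      exact ⟨_, Or.inr rfl, armOn_squareArm hadj hbe hve hee.symm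
        ⟨fun h => hb (h ▸ he), hcom e he hve⟩
        ⟨fun h => (hsup e' he').2 (h ▸ htv), fun h => hcom e' he' h hbe⟩ (hsup e' he') (hsup e he)⟩
  · have hsup' : ∀ u ∈ (Walk.cons hvv (q.append r.reverse)).support, G.Adj t u → u = v := by
      intro u hu htu
      rw [Walk.support_cons, List.mem_cons] at hu
      exact hu.resolve_right fun h => (hsup u h).2 htu
    rcases exists_common_or_square h4 htb (Walk.cons hvv (q.append r.reverse)) htv hbb (by
        rw [Walk.support_cons, List.mem_cons]
        rintro (h | h)
        · exact htp (h ▸ hvp)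
        · exact (hsup t h).1.elim htp htr) (by
        rw [Walk.support_cons, List.mem_cons]
        rintro (h | h)
        · exact hbv h
        · exact hb h) with ⟨e, he, hte, hbe⟩ | ⟨e, he, e', he', hee, hte, hbe⟩
    · obtain rfl := hsup' e he hte
      exact (hadj hbe).elim
    · obtain rfl := hsup' e he hte
      rw [Walk.support_cons, List.mem_cons] at he'
      rcases he' with rfl | he'
      · exact (hee.ne rfl).elim
      · exact ⟨_, Or.inl ⟨false, rfl⟩,
          armOn_dottedArm hbv hbe.symm hee.symm (by simpa) (hsup e' he')⟩

/-- A two-armed graph arises as soon as the common neighbour `t` of `b` and `c` has a neighbour `w`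
on the level of `c` below it, and sees a walk that stays above `t`, avoids the neighbours of `a`
and ends where `b` can get to above `t`. -/
theorem hasForbidden_of_two (hc : G.Connected) (h4 : IsKChordal 4 G) {x y a b c t w v₀ b₂ : V}
    {i : ℕ} (hxc : G.dist x c = i) (hxw : G.dist x w = i) (hxt : G.dist x t = i + 1)
    (hxa : G.dist x a = i + 1) (hxb : G.dist x b = i + 2) (hac : G.Adj a c) (hab : G.Adj a b)
    (htc : G.Adj t c) (htb : G.Adj t b) (htw : G.Adj t w) (htv : G.Adj t v₀) (hbb : G.Adj b b₂)
    (hat : Apart G a t) (haw : Apart G a w) (p : G.Walk v₀ y) (r : G.Walk b₂ y)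
    (hp : ∀ u ∈ p.support, i + 2 ≤ G.dist x u ∧ Apart G a u)
    (hr : ∀ u ∈ r.support, i + 2 ≤ G.dist x u ∧ Apart G a u ∧ ¬ G.Adj t u) :
    HasForbidden G := by
  have hcw : c ≠ w := fun h => haw.2 (h ▸ hac)
  obtain ⟨A, hA, hAon⟩ := exists_roof hc h4 (descends_univ hc x) (Set.mem_univ c) (Set.mem_univ w)
    hxc hxw hcw htc htw (by omega)
  obtain ⟨v, hvp, htv, B, hB, hBon⟩ := exists_dotted_or_square h4 p r htb htv hbb
    (fun u hu => (hr u hu).2.2) (fun h => (hp b h).2.2 hab) (fun h => (hr b h).2.1.2 hab)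
    (fun h => by have := (hp t h).1; omega) (fun h => by have := (hr t h).1; omega)
  have hpr : ∀ u, (u ∈ p.support ∨ u ∈ r.support) → i + 2 ≤ G.dist x u ∧ Apart G a u := by
    rintro u (hu | hu)
    · exact hp u hu
    · exact ⟨(hr u hu).1, (hr u hu).2.1⟩
  have hemb : twoArms A B ⊴ G := by
    refine twoArms_isIndContained hAon hBon hcw (fun h => (hp v hvp).2.2 (h ▸ hab)) hac hab htc htb
      htw htv hat haw (hp v hvp).2 ?_ ?_ ?_
    · rintro s ⟨-, hs⟩
      exact ⟨(apart_of_dist_lt hc x (by omega)).symm, (apart_of_dist_lt hc x (by omega)).symm⟩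
    · rintro s ⟨hs, hts⟩
      refine ⟨(hpr s hs).2, ?_, hts⟩
      rintro rfl
      have := (hpr _ hs).1
      omega
    · intro s hs s' hs'
      have h₁ : G.dist x s ≤ i := by
        rcases hs with rfl | rfl | ⟨-, hs⟩ <;> omega
      have h₂ : i + 2 ≤ G.dist x s' := by
        rcases hs' with rfl | rfl | hs'
        · omega
        · exact (hp _ hvp).1
        · exact (hpr s' hs'.1).1
      exact apart_of_dist_lt hc x (by omega)
  rcases hA with ⟨d, rfl⟩ | ⟨k, rfl⟩ <;> rcases hB with ⟨e, rfl⟩ | rfl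
  · exact ⟨_, _, Forbidden.two_dotted_dotted d e, hemb⟩
  · exact ⟨_, _, Forbidden.two_dotted_square d, hemb⟩
  · exact ⟨_, _, Forbidden.two_building_dotted k e, hemb⟩
  · exact ⟨_, _, Forbidden.two_building_square k, hemb⟩

/-! ### Three-armed graphs -/

/-- A three-armed graph arises when `b` and `c` have two common neighbours `t` and `t'`, where `t`
continues to `x` past `c` only, `t'` continues to `y` past `b` only, and both descend to `z`. -/
theorem hasForbidden_of_three (hc : G.Connected) (h4 : IsKChordal 4 G)
    {x y z a b c t t' w v : V} {i j k : ℕ} {U : Set V} (hxy : G.dist x y = i + j + 2)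
    (hxz : G.dist x z = i + 1 + k) (hyz : G.dist y z = j + 1 + k) (hxc : G.dist x c = i)
    (hxw : G.dist x w = i) (hyb : G.dist y b = j) (hyv : G.dist y v = j) (hzt : G.dist z t = k)
    (hzt' : G.dist z t' = k) (hac : G.Adj a c) (hab : G.Adj a b) (htc : G.Adj t c)
    (htb : G.Adj t b) (htc' : G.Adj t' c) (htb' : G.Adj t' b) (htw : G.Adj t w)
    (htv : G.Adj t' v) (htt : t ≠ t') (haw : Apart G a w)
    (hav : Apart G a v) (htv' : Apart G t v) (htw' : Apart G t' w) (hU : Descends G z U)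
    (htU : t ∈ U) (htU' : t' ∈ U) (haU : ∀ u ∈ U, Apart G a u) : HasForbidden G := by
  have hcw : c ≠ w := fun h => haw.2 (h ▸ hac)
  have hbv : b ≠ v := fun h => hav.2 (h ▸ hab)
  have mid : ∀ s, G.Adj s c → G.Adj s b → G.dist x s = i + 1 ∧ G.dist y s = j + 1 := by
    intro s h₁ h₂
    have := dist_le_of_adj hc x h₁.symm
    have := dist_le_of_adj hc y h₂.symm
    have := dist_le_add hc x y s
    omega
  have ha := mid a hac hab
  have ht := mid t htc htb
  have ht' := mid t' htc' htb'
  obtain ⟨A, hA, hAon⟩ := exists_roof hc h4 (descends_univ hc x) (Set.mem_univ c) (Set.mem_univ w)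
    hxc hxw hcw htc htw (by omega)
  obtain ⟨B, hB, hBon⟩ := exists_roof hc h4 (descends_univ hc y) (Set.mem_univ b) (Set.mem_univ v)
    hyb hyv hbv htb' htv (by omega)
  have hzc : k < G.dist z c := by
    have := dist_le_add hc x z c
    omega
  obtain ⟨C, hC, hCon⟩ := exists_roof hc h4 hU htU htU' hzt hzt' htt htc.symm htc'.symm hzc
  obtain ⟨C', hC', hCon'⟩ := exists_roof hc h4 hU htU' htU hzt' hzt htt.symm htc'.symm htc.symm hzc
  have hlowA : ∀ s, (s = c ∨ s = w ∨ s ∈ {u | u ∈ Set.univ ∧ G.dist x u < i}) →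
      G.dist x s ≤ i := by
    rintro s (rfl | rfl | ⟨-, hs⟩) <;> omega
  have hlowB : ∀ s, (s = b ∨ s = v ∨ s ∈ {u | u ∈ Set.univ ∧ G.dist y u < j}) →
      G.dist y s ≤ j := by
    rintro s (rfl | rfl | ⟨-, hs⟩) <;> omega
  have hS : ∀ s ∈ {u | u ∈ Set.univ ∧ G.dist x u < i},
      Apart G a s ∧ Apart G t s ∧ Apart G t' s := by
    rintro s ⟨-, hs⟩
    exact ⟨(apart_of_dist_lt hc x (by omega)).symm, (apart_of_dist_lt hc x (by omega)).symm,
      (apart_of_dist_lt hc x (by omega)).symm⟩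
  have hT : ∀ s ∈ {u | u ∈ Set.univ ∧ G.dist y u < j},
      Apart G a s ∧ Apart G t s ∧ Apart G t' s := by
    rintro s ⟨-, hs⟩
    exact ⟨(apart_of_dist_lt hc y (by omega)).symm, (apart_of_dist_lt hc y (by omega)).symm,
      (apart_of_dist_lt hc y (by omega)).symm⟩
  have hAB : ∀ s, (s = c ∨ s = w ∨ s ∈ {u | u ∈ Set.univ ∧ G.dist x u < i}) →
      ∀ s', (s' = b ∨ s' = v ∨ s' ∈ {u | u ∈ Set.univ ∧ G.dist y u < j}) → Apart G s s' := by
    intro s hs s' hs'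
    have := hlowA s hs
    have := hlowB s' hs'
    have := dist_le_add hc x y s'
    exact apart_of_dist_lt hc x (by omega)
  have hCA : ∀ s ∈ {u | u ∈ U ∧ G.dist z u < k}, ∀ s',
      (s' = c ∨ s' = w ∨ s' ∈ {u | u ∈ Set.univ ∧ G.dist x u < i}) → Apart G s s' := by
    rintro s ⟨-, hs⟩ s' hs'
    have := hlowA s' hs'
    have := dist_le_add hc x z s
    exact (apart_of_dist_lt hc x (by omega)).symm
  have hCB : ∀ s ∈ {u | u ∈ U ∧ G.dist z u < k}, ∀ s',
      (s' = b ∨ s' = v ∨ s' ∈ {u | u ∈ Set.univ ∧ G.dist y u < j}) → Apart G s s' := by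
    rintro s ⟨-, hs⟩ s' hs'
    have := hlowB s' hs'
    have := dist_le_add hc y z s
    exact (apart_of_dist_lt hc y (by omega)).symm
  have hemb : threeArms A B C ⊴ G :=
    threeArms_isIndContained hAon hBon hCon hcw hbv htt hac hab htc htb htc' htb' htw htv
      (haU t htU) (haU t' htU') haw hav htv' htw' hS hT (fun s hs => haU s hs.1) hAB hCA hCB
  have hemb' : threeArms B A C' ⊴ G :=
    threeArms_isIndContained hBon hAon hCon' hbv hcw htt.symm hab hac htb' htc' htb htc htv htw
      (haU t' htU') (haU t htU) hav haw htw' htv' (fun s hs => ⟨(hT s hs).1, (hT s hs).2.symm⟩)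
      (fun s hs => ⟨(hS s hs).1, (hS s hs).2.symm⟩) (fun s hs => haU s hs.1)
      (fun s hs s' hs' => (hAB s' hs' s hs).symm) hCB hCA
  rcases hA with ⟨d, rfl⟩ | ⟨l, rfl⟩ <;> rcases hB with ⟨e, rfl⟩ | ⟨m, rfl⟩
  · rcases hC with ⟨f, rfl⟩ | ⟨n, rfl⟩
    · exact ⟨_, _, Forbidden.three_dotted_dotted_dotted d e f, hemb⟩
    · exact ⟨_, _, Forbidden.three_dotted_dotted_building d e n, hemb⟩
  -- The list of forbidden graphs has the building first; exchange the roles of `x` and `y`.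
  · rcases hC' with ⟨f, rfl⟩ | ⟨n, rfl⟩
    · exact ⟨_, _, Forbidden.three_building_dotted_dotted m d f, hemb'⟩
    · exact ⟨_, _, Forbidden.three_building_dotted_building m d n, hemb'⟩
  · rcases hC with ⟨f, rfl⟩ | ⟨n, rfl⟩
    · exact ⟨_, _, Forbidden.three_building_dotted_dotted l e f, hemb⟩
    · exact ⟨_, _, Forbidden.three_building_dotted_building l e n, hemb⟩
  · rcases hC with ⟨f, rfl⟩ | ⟨n, rfl⟩
    · exact ⟨_, _, Forbidden.three_building_building_dotted l m f, hemb⟩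
    · exact ⟨_, _, Forbidden.three_building_building_building l m n, hemb⟩

/-! ### From a fat triangle to a forbidden graph -/

/-- If `c`, `a`, `b` are consecutive on a shortest path from `x` to `y`, every walk from `x` to `y`
that avoids the closed neighbourhood of `a` contains a common neighbour of `c` and `b`. -/
theorem exists_common_neighbor (hc : G.Connected) (h4 : IsKChordal 4 G) {x y a b c : V} {i j : ℕ}
    (hi : 1 ≤ i) (hxy : G.dist x y = i + j + 2) (hxc : G.dist x c = i) (hyb : G.dist y b = j)
    (hac : G.Adj a c) (hab : G.Adj a b) (p : G.Walk x y) (hp : ∀ u ∈ p.support, Apart G a u) :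
    ∃ t ∈ p.support, G.Adj t c ∧ G.Adj t b := by
  have h₁ := dist_le_of_adj hc x hac.symm
  have h₂ := dist_le_of_adj hc x hab
  have h₃ := dist_le_of_adj hc y hab.symm
  have h₄ := dist_le_of_adj hc y hac
  have h₅ := dist_le_add hc x y b
  have h₆ := dist_le_add hc x y c
  obtain ⟨m, rfl⟩ := Nat.exists_eq_add_of_le' hi
  obtain ⟨c', hcc, hc'⟩ := exists_adj_dist hc hxc
  obtain ⟨q, hq⟩ := (descends_univ hc x).exists_walk hc (Set.mem_univ c') hc'
  obtain ⟨r, hr⟩ := (descends_univ hc y).exists_walk hc (Set.mem_univ b) hyb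
  have hsup : ∀ u ∈ (r.append (p.reverse.append q.reverse)).support,
      u = b ∨ G.dist y u < j ∨ u ∈ p.support ∨ G.dist x u ≤ m := by
    intro u hu
    simp only [Walk.mem_support_append_iff, Walk.support_reverse, List.mem_reverse] at hu
    rcases hu with hu | hu | hu
    · rcases hr u hu with h | h
      · exact Or.inl h
      · exact Or.inr (Or.inl h.2)
    · exact Or.inr (Or.inr (Or.inl hu))
    · rcases hq u hu with rfl | h
      · exact Or.inr (Or.inr (Or.inr hc'.le))
      · exact Or.inr (Or.inr (Or.inr h.2.le))
  have hasup : ∀ u ∈ (r.append (p.reverse.append q.reverse)).support, G.Adj a u → u = b := by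
    intro u hu hau
    have := dist_le_of_adj hc x hau.symm
    have := dist_le_of_adj hc y hau.symm
    rcases hsup u hu with h | h | h | h
    · exact h
    · omega
    · exact ((hp u h).2 hau).elim
    · omega
  have hbc : ¬ G.Adj c b := by
    intro h
    have := dist_le_of_adj hc x h
    omega
  rcases exists_common_or_square h4 hac (r.append (p.reverse.append q.reverse)) hab hcc (by
      intro h
      rcases hsup a h with h | h | h | h
      · exact hab.ne h
      · omega
      · exact (hp a h).1 rfl
      · omega) (by
      intro h
      rcases hsup c h with h | h | h | h
      · subst h; omega
      · omega
      · exact (hp c h).2 hac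
      · omega) with ⟨e, he, hae, hce⟩ | ⟨e, he, t, ht, hbt, hae, hct⟩
  · obtain rfl := hasup e he hae
    exact (hbc hce).elim
  · obtain rfl := hasup e he hae
    have h₇ := dist_le_of_adj hc x hbt.symm
    have h₈ := dist_le_of_adj hc y hct.symm
    rcases hsup t ht with rfl | h | h | h
    · exact (hbt.ne rfl).elim
    · omega
    · exact ⟨t, h, hct.symm, hbt.symm⟩
    · omega

/-- If `a` and `t` lie one level above `c` and `w`, with `a` adjacent to `c` but not to `w` and `t`
adjacent to `w`, and `a` and `t` have a common neighbour `b` above them, then `t` is adjacent to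
`c`, because otherwise `c`, `a`, `b`, `t`, `w` belong to an induced cycle through lower levels. -/
theorem adj_of_level (hc : G.Connected) (h4 : IsKChordal 4 G) {x a b c t w : V} {i : ℕ}
    (hxc : G.dist x c = i) (hxw : G.dist x w = i) (hxa : i + 1 = G.dist x a)
    (hxb : i + 2 = G.dist x b) (hac : G.Adj a c) (hab : G.Adj a b) (htb : G.Adj t b)
    (htw : G.Adj t w) (haw : Apart G a w) (hat : Apart G a t) : G.Adj t c := by
  obtain ⟨p, hp⟩ := (descends_univ hc x).exists_walk hc (Set.mem_univ c) hxc
  obtain ⟨q, hq⟩ := (descends_univ hc x).exists_walk hc (Set.mem_univ w) hxw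
  have hsup : ∀ u ∈ (p.append (Walk.cons htw q).reverse).support,
      u = c ∨ u = t ∨ u = w ∨ G.dist x u < i := by
    intro u hu
    simp only [Walk.mem_support_append_iff, Walk.support_reverse, List.mem_reverse,
      Walk.support_cons, List.mem_cons] at hu
    rcases hu with hu | hu | hu
    · rcases hp u hu with h | h
      · exact Or.inl h
      · exact Or.inr (Or.inr (Or.inr h.2))
    · exact Or.inr (Or.inl hu)
    · rcases hq u hu with h | h
      · exact Or.inr (Or.inr (Or.inl h))
      · exact Or.inr (Or.inr (Or.inr h.2))
  have ha : ∀ u ∈ (p.append (Walk.cons htw q).reverse).support, G.Adj a u → u = c := by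
    intro u hu hau
    have := dist_le_of_adj hc x hau.symm
    rcases hsup u hu with h | rfl | rfl | h
    · exact h
    · exact (hat.2 hau).elim
    · exact (haw.2 hau).elim
    · omega
  have hb : ∀ u ∈ (p.append (Walk.cons htw q).reverse).support, G.Adj b u → u = t := by
    intro u hu hbu
    have := dist_le_of_adj hc x hbu.symm
    rcases hsup u hu with rfl | h | rfl | h
    · omega
    · exact h
    · omega
    · omega
  rcases exists_common_or_square h4 hab (p.append (Walk.cons htw q).reverse) hac htb.symm (by
      intro h
      rcases hsup a h with rfl | rfl | rfl | h
      · omega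
      · exact hat.1 rfl
      · omega
      · omega) (by
      intro h
      rcases hsup b h with rfl | rfl | rfl | h
      · omega
      · exact htb.ne rfl
      · omega
      · omega) with ⟨e, he, hae, hbe⟩ | ⟨e, he, e', he', hee, hae, hbe⟩
  · obtain rfl := ha e he hae
    have := dist_le_of_adj hc x hbe.symm
    omega
  · obtain rfl := ha e he hae
    obtain rfl := hb e' he' hbe
    exact hee.symm

/-- The vertex `a` of a shortest path from `x` to `y` is far from the two other sides `q`, `r`, and
`q` contains a common neighbour of the two neighbours `c`, `b` of `a` on that path. -/
theorem hasForbidden_of_common_neighbor (hc : G.Connected) (h4 : IsKChordal 4 G)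
    {x y z a b c t : V} {i j : ℕ}
    (hi : 1 ≤ i) (hj : 1 ≤ j) (hxy : G.dist x y = i + j + 2) (hxc : G.dist x c = i)
    (hyb : G.dist y b = j) (hac : G.Adj a c) (hab : G.Adj a b) {q : G.Walk x z} {r : G.Walk y z}
    (hq : IsShortest q) (hr : IsShortest r) (haq : ∀ u ∈ q.support, Apart G a u)
    (har : ∀ u ∈ r.support, Apart G a u) (ht : t ∈ q.support) (htc : G.Adj t c)
    (htb : G.Adj t b) : HasForbidden G := by
  have mid : ∀ s c', G.dist x c' = i → G.Adj s c' → G.Adj s b →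
      G.dist x s = i + 1 ∧ G.dist y s = j + 1 := by
    intro s c' h₀ h₁ h₂
    have := dist_le_of_adj hc x h₁.symm
    have := dist_le_of_adj hc y h₂.symm
    have := dist_le_add hc x y s
    omega
  obtain ⟨hxa, hya⟩ := mid a c hxc hac hab
  obtain ⟨hxt, hyt⟩ := mid t c hxc htc htb
  have hxb : G.dist x b = i + 2 := by
    have := dist_le_of_adj hc x hab
    have := dist_le_add hc x y b
    omega
  obtain ⟨m, rfl⟩ := Nat.exists_eq_add_of_le' hj
  obtain ⟨b', hbb, hb'⟩ := exists_adj_dist hc hyb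
  obtain ⟨s, hs⟩ := (descends_univ hc y).exists_walk hc (Set.mem_univ b') hb'
  have hs' : ∀ u ∈ s.support, G.dist y u ≤ m := by
    intro u hu
    rcases hs u hu with rfl | h
    · exact hb'.le
    · exact h.2.le
  -- A common neighbour of `c` and `b` that continues to `x`, and upwards to `y`, outside the
  -- neighbourhood of `a`, leads to a two-armed graph.
  have two : ∀ t w v₀ (p : G.Walk v₀ y), G.Adj t c → G.Adj t b → G.dist x w = i → G.Adj t w →
      Apart G a w → Apart G a t → G.Adj t v₀ →
      (∀ u ∈ p.support, i + 2 ≤ G.dist x u ∧ Apart G a u) → HasForbidden G := by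
    intro t w v₀ p htc htb hxw htw haw hat htv hp
    obtain ⟨hxt, hyt⟩ := mid t c hxc htc htb
    refine hasForbidden_of_two hc h4 hxc hxw hxt hxa hxb hac hab htc htb htw htv hbb hat haw p s
      hp fun u hu => ?_
    have h₁ := hs' u hu
    have h₂ := dist_le_add hc x y u
    refine ⟨by omega, (apart_of_dist_lt hc y (by omega)).symm, fun h => ?_⟩
    have := dist_le_of_adj hc y h.symm
    omega
  have bigon : ∀ t w v₀, G.Adj t c → G.Adj t b → G.dist x w = i → G.Adj t w →
      Apart G a w → Apart G a t → G.Adj t v₀ → G.dist y v₀ = m + 1 → Apart G a v₀ →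
      HasForbidden G := by
    intro t w v₀ htc htb hxw htw haw hat htv hyv hav
    obtain ⟨p, hp⟩ := (descends_univ hc y).exists_walk hc (Set.mem_univ v₀) hyv
    refine two t w v₀ p htc htb hxw htw haw hat htv fun u hu => ?_
    have h₂ := dist_le_add hc x y u
    rcases hp u hu with rfl | h
    · exact ⟨by omega, hav⟩
    · exact ⟨by omega, (apart_of_dist_lt hc y (by omega)).symm⟩
  have hat := haq t ht
  obtain ⟨w, hwq, htw, hxw⟩ := hq.descends hc t ht i hxt
  have haw := haq w hwq
  by_cases htr : t ∈ r.support
  · obtain ⟨v, hvr, htv, hyv⟩ := hr.descends hc t htr _ hyt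
    exact bigon t w v htc htb hxw htw haw hat htv hyv (har v hvr)
  have htz : t ≠ z := fun h => htr (h ▸ r.end_mem_support)
  obtain ⟨v, q', htv, hq'⟩ := hq.exists_tail hc ht htz
  by_cases hrx : ∀ u ∈ r.support, i + 2 ≤ G.dist x u
  · refine two t w v (q'.append r.reverse) htc htb hxw htw haw hat htv fun u hu => ?_
    rw [Walk.mem_support_append_iff, Walk.support_reverse, List.mem_reverse] at hu
    rcases hu with hu | hu
    · have := (hq' u hu).2
      exact ⟨by omega, haq u (hq' u hu).1⟩
    · exact ⟨hrx u hu, har u hu⟩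
  push Not at hrx
  obtain ⟨t', ht'r, hxt'⟩ := hrx
  have hzt := hq.dist_add_dist hc ht
  have hzt' := hr.dist_add_dist hc ht'r
  -- The triangle inequalities through `t` and `t'` force `t'` to be level with `t`.
  have h₁ := dist_le_add hc y z t
  have h₂ := dist_le_add hc x z t'
  have h₃ := dist_le_add hc x y t'
  have hyt' : G.dist y t' = m + 1 + 1 := by omega
  have hxt'' : G.dist x t' = i + 1 := by omega
  have hat' := har t' ht'r
  obtain ⟨v', hv'r, htv', hyv'⟩ := hr.descends hc t' ht'r _ hyt'
  have hav' := har v' hv'r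
  by_cases hw' : ∃ w', G.Adj t' w' ∧ G.dist x w' = i ∧ Apart G a w'
  · obtain ⟨w', htw', hxw', haw'⟩ := hw'
    obtain ⟨p₁, hp₁⟩ := (descends_univ hc x).exists_walk hc (Set.mem_univ w') hxw'
    obtain ⟨p₂, hp₂⟩ := (descends_univ hc y).exists_walk hc (Set.mem_univ v') hyv'
    have hsup : ∀ u ∈ (p₁.reverse.append (Walk.cons htw'.symm (Walk.cons htv' p₂))).support,
        u = t' ∨ (G.dist x u ≤ i ∧ Apart G a u) ∨ (G.dist y u ≤ m + 1 ∧ Apart G a u) := by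
      intro u hu
      simp only [Walk.mem_support_append_iff, Walk.support_reverse, List.mem_reverse,
        Walk.support_cons, List.mem_cons] at hu
      have hlow : u ∈ p₁.support → G.dist x u ≤ i ∧ Apart G a u := by
        intro hu
        rcases hp₁ u hu with rfl | h
        · exact ⟨hxw'.le, haw'⟩
        · exact ⟨h.2.le, (apart_of_dist_lt hc x (by omega)).symm⟩
      rcases hu with hu | rfl | rfl | hu
      · exact Or.inr (Or.inl (hlow hu))
      · exact Or.inr (Or.inl ⟨hxw'.le, haw'⟩)
      · exact Or.inl rfl
      · rcases hp₂ u hu with rfl | h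
        · exact Or.inr (Or.inr ⟨hyv'.le, hav'⟩)
        · exact Or.inr (Or.inr ⟨h.2.le, (apart_of_dist_lt hc y (by omega)).symm⟩)
    obtain ⟨t₀, ht₀, htc₀, htb₀⟩ := exists_common_neighbor hc h4 hi hxy hxc hyb hac hab _
      (fun u hu => by
        rcases hsup u hu with rfl | h | h
        · exact hat'
        · exact h.2
        · exact h.2)
    have hm := mid t₀ c hxc htc₀ htb₀
    obtain rfl : t₀ = t' := by
      rcases hsup t₀ ht₀ with h | h | h
      · exact h
      · omega
      · omega
    exact bigon t₀ w' v' htc₀ htb₀ hxw' htw' haw' hat' htv' hyv' hav'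
  · push Not at hw'
    -- All neighbours of `t'` below it are neighbours of `a`; let one of them play the role of `c`.
    obtain ⟨c', htc', hxc'⟩ := exists_adj_dist hc hxt''
    have hac' : G.Adj a c' := by
      by_contra h
      refine hw' c' htc' hxc' ⟨?_, h⟩
      rintro rfl
      omega
    have htc'' : G.Adj t c' :=
      adj_of_level hc h4 hxc' hxw hxa.symm hxb.symm hac' hab htb htw haw hat
    have hyc' : m + 1 + 2 = G.dist y c' := by
      have := dist_le_of_adj hc y hac'
      have := dist_le_add hc x y c'
      omega
    have htb' : G.Adj t' b :=
      adj_of_level hc h4 hyb hyv' hya.symm hyc' hab hac' htc' htv' hav' hat'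
    have htw' : Apart G t' w := by
      refine ⟨?_, fun h => hw' w h hxw haw⟩
      rintro rfl
      omega
    by_cases htv'' : G.Adj t v'
    · exact bigon t w v' htc htb hxw htw haw hat htv'' hyv' hav'
    have htt : t ≠ t' := fun h => htr (h ▸ ht'r)
    refine hasForbidden_of_three hc h4 (k := G.dist z t) (U := {u | u ∈ q.support} ∪
      {u | u ∈ r.support}) hxy (by omega) (by omega) hxc' hxw hyb hyv' rfl (by omega) hac' hab
      htc'' htb htc' htb' htw htv' htt haw hav' ⟨?_, htv''⟩ htw' ?_ (Or.inl ht) (Or.inr ht'r) ?_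
    · rintro rfl
      omega
    · have h₁ := hq.reverse.descends hc
      have h₂ := hr.reverse.descends hc
      simp only [Walk.support_reverse, List.mem_reverse] at h₁ h₂
      exact h₁.union h₂
    · rintro u (hu | hu)
      · exact haq u hu
      · exact har u hu

/-- Whichever of the two sides contains the common neighbour, the situation is symmetric under the
exchange of `x` and `y`. -/
theorem hasForbidden_of_far_of_connected (hc : G.Connected) (h4 : IsKChordal 4 G) {x y z a : V}
    {p : G.Walk x y} {q : G.Walk x z} {r : G.Walk y z} (hp : IsShortest p) (hq : IsShortest q)
    (hr : IsShortest r) (ha : a ∈ p.support) (haq : ∀ u ∈ q.support, Apart G a u)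
    (har : ∀ u ∈ r.support, Apart G a u) : HasForbidden G := by
  obtain ⟨k, rfl, hk⟩ := Walk.mem_support_iff_exists_getVert.1 ha
  have hax := haq x q.start_mem_support
  have hay := har y r.start_mem_support
  have hlen : p.length = G.dist x y := hp
  have h0 : k ≠ 0 := by
    rintro rfl
    exact hax.1 p.getVert_zero
  obtain ⟨i, rfl⟩ := Nat.exists_eq_succ_of_ne_zero h0
  have hk' : i + 1 ≠ p.length := by
    intro h
    exact hay.1 (by rw [Nat.succ_eq_add_one, h, p.getVert_length])
  have hac : G.Adj (p.getVert (i + 1)) (p.getVert i) := (p.adj_getVert_succ (by omega)).symm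
  have hab : G.Adj (p.getVert (i + 1)) (p.getVert (i + 2)) := p.adj_getVert_succ (by omega)
  have hi : i ≠ 0 := by
    rintro rfl
    rw [p.getVert_zero] at hac
    exact hax.2 hac
  have hj : i + 2 ≠ p.length := by
    intro h
    rw [h, p.getVert_length] at hab
    exact hay.2 hab
  have hxc : G.dist x (p.getVert i) = i := hp.dist_getVert hc (by omega)
  have hxb : G.dist x (p.getVert (i + 2)) = i + 2 := hp.dist_getVert hc (by omega)
  have hyb := hp.dist_add_dist hc (p.getVert_mem_support (i + 2))
  have hyc := hp.dist_add_dist hc (p.getVert_mem_support i)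
  obtain ⟨j, hj'⟩ : ∃ j, G.dist y (p.getVert (i + 2)) = j := ⟨_, rfl⟩
  have hxy : G.dist x y = i + j + 2 := by omega
  have hyx : G.dist y x = j + i + 2 := by
    rw [dist_comm]
    omega
  obtain ⟨t, ht, htc, htb⟩ := exists_common_neighbor hc h4 (by omega) hxy hxc hj' hac hab
    (q.append r.reverse) (by
      intro u hu
      rw [Walk.mem_support_append_iff, Walk.support_reverse, List.mem_reverse] at hu
      exact hu.elim (haq u) (har u))
  rw [Walk.mem_support_append_iff, Walk.support_reverse, List.mem_reverse] at ht
  rcases ht with ht | ht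
  · exact hasForbidden_of_common_neighbor hc h4 (by omega) (by omega) hxy hxc hj' hac hab hq hr haq
      har ht htc htb
  · exact hasForbidden_of_common_neighbor hc h4 (by omega) (by omega) hyx hj' hxc hab hac hr hq har
      haq ht htb htc

/-! ### Slimness from the absence of forbidden graphs -/

theorem IsKChordal.induce {k : ℕ} (h : IsKChordal k G) (s : Set V) : IsKChordal k (G.induce s) :=
  fun n hn hcyc => h n hn (hcyc.trans ⟨Embedding.induce s⟩)

theorem HasForbidden.of_induce {s : Set V} (h : HasForbidden (G.induce s)) : HasForbidden G := by
  obtain ⟨W, H, hH, hcont⟩ := h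
  exact ⟨W, H, hH, hcont.trans ⟨Embedding.induce s⟩⟩

theorem IsShortest.induce {s : Set V} {x y : V} {p : G.Walk x y} (hp : IsShortest p)
    (hs : ∀ u ∈ p.support, u ∈ s) : IsShortest (p.induce s hs) := by
  have hlen : (p.induce s hs).length = p.length := by
    rw [← Walk.length_map (Embedding.induce s).toHom, Walk.map_induce]
    rfl
  have hp' : p.length = G.dist x y := hp
  refine le_antisymm ?_ (dist_le _)
  · obtain ⟨q, hq⟩ := (p.induce s hs).reachable.exists_walk_length_eq_dist
    have := dist_le (q.map (Embedding.induce s).toHom)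
    rw [Walk.length_map] at this
    rw [hlen, hp', ← hq]
    exact this

theorem hasForbidden_of_far (h4 : IsKChordal 4 G) {x y z a : V}
    {p : G.Walk x y} {q : G.Walk x z} {r : G.Walk y z} (hp : IsShortest p) (hq : IsShortest q)
    (hr : IsShortest r) (ha : a ∈ p.support) (haq : ∀ u ∈ q.support, Apart G a u)
    (har : ∀ u ∈ r.support, Apart G a u) : HasForbidden G := by
  classical
  -- Pass to the component of `x`, where all distances are genuine.
  let s : Set V := {u | G.Reachable x u}
  have hps : ∀ u ∈ p.support, u ∈ s := fun u hu => ⟨p.takeUntil u hu⟩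
  have hqs : ∀ u ∈ q.support, u ∈ s := fun u hu => ⟨q.takeUntil u hu⟩
  have hrs : ∀ u ∈ r.support, u ∈ s := fun u hu => ⟨p.append (r.takeUntil u hu)⟩
  have hc : (G.induce s).Connected := by
    have hx : x ∈ s := Reachable.refl x
    refine (connected_iff_exists_forall_reachable _).2 ⟨⟨x, hx⟩, ?_⟩
    rintro ⟨u, ⟨w⟩⟩
    exact ⟨w.induce s fun v hv => ⟨w.takeUntil v hv⟩⟩
  have hmem : ∀ {u v : V} (w : G.Walk u v) (hw : ∀ e ∈ w.support, e ∈ s) (e : s),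
      e ∈ (w.induce s hw).support ↔ e.1 ∈ w.support := by
    intro u v w hw e
    rw [Walk.support_induce, List.mem_attachWith]
  have hap : ∀ u : s, Apart G a u → Apart (G.induce s) ⟨a, hps a ha⟩ u := by
    intro u hu
    exact ⟨fun h => hu.1 (congrArg Subtype.val h), hu.2⟩
  refine HasForbidden.of_induce (s := s) (hasForbidden_of_far_of_connected hc (h4.induce s)
    (hp.induce hps) (hq.induce hqs) (hr.induce hrs) (a := ⟨a, hps a ha⟩)
    ((hmem p hps _).2 ha) ?_ ?_)
  · intro u hu
    exact hap u (haq u ((hmem q hqs u).1 hu))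
  · intro u hu
    exact hap u (har u ((hmem r hrs u).1 hu))

theorem isSlim_one_of_not_hasForbidden (h4 : IsKChordal 4 G) (h : ¬ HasForbidden G) :
    IsSlim G 1 := by
  have key : ∀ {x y z : V} (p : G.Walk x y) (q : G.Walk x z) (r : G.Walk y z), IsShortest p →
      IsShortest q → IsShortest r → SideClose G 1 p.support q.support r.support := by
    intro x y z p q r hp hq hr a ha
    by_contra hcon
    push Not at hcon
    have hap : ∀ u, (u ∈ q.support ∨ u ∈ r.support) → Apart G a u := by
      intro u hu
      have := hcon u hu
      rw [← not_le, edist_le_one_iff_adj_or_eq, not_or] at this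
      exact ⟨this.2, this.1⟩
    exact h (hasForbidden_of_far h4 hp hq hr ha (fun u hu => hap u (Or.inl hu))
      fun u hu => hap u (Or.inr hu))
  intro x y z p q r hp hq hr
  refine ⟨key p q r hp hq hr, ?_, ?_⟩
  · have := key q p r.reverse hq hp hr.reverse
    simpa only [SideClose, Walk.support_reverse, List.mem_reverse] using this
  · have := key r p.reverse q.reverse hr hp.reverse hq.reverse
    simpa only [SideClose, Walk.support_reverse, List.mem_reverse] using this

theorem slimness_le_iff {δ : ℕ∞} : slimness G ≤ δ ↔ IsSlim G δ := by
  refine ⟨fun h => ?_, fun h => (isLeast_slimness G).2 h⟩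
  intro x y z p q r hp hq hr
  obtain ⟨h₁, h₂, h₃⟩ := (isLeast_slimness G).1 x y z p q r hp hq hr
  have mono : ∀ {P Q R : List V}, SideClose G (slimness G) P Q R → SideClose G δ P Q R := by
    intro P Q R hPQR u hu
    obtain ⟨v, hv, hd⟩ := hPQR u hu
    exact ⟨v, hv, hd.trans h⟩
  exact ⟨mono h₁, mono h₂, mono h₃⟩

/-! ### The forbidden graphs are not slim -/

theorem sub_le_length {W : Type*} {H : SimpleGraph W} {f : W → ℕ}
    (hf : ∀ u v, H.Adj u v → f v ≤ f u + 1) {x y : W} (p : H.Walk x y) :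
    f y ≤ f x + p.length := by
  induction p with
  | nil => simp
  | cons h p ih =>
    have := hf _ _ h
    rw [Walk.length_cons]
    omega

/-- A function that changes by at most one along edges certifies a walk as a shortest path. -/
theorem isShortest_of_potential {W : Type*} {H : SimpleGraph W} (f : W → ℕ)
    (hf : ∀ u v, H.Adj u v → f v ≤ f u + 1) {x y : W} (p : H.Walk x y)
    (hp : f x + p.length ≤ f y) : IsShortest p := by
  refine le_antisymm ?_ (dist_le p)
  obtain ⟨q, hq⟩ := p.reachable.exists_walk_length_eq_dist
  have := sub_le_length hf q
  omega

theorem edist_map_le {W W' : Type*} {H : SimpleGraph W} {H' : SimpleGraph W'} (g : H →g H')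
    (x y : W) : H'.edist (g x) (g y) ≤ H.edist x y := by
  refine le_iInf fun w => ?_
  have := edist_le (w.map g)
  rwa [Walk.length_map] at this

theorem IsSlim.of_iso {W W' : Type*} {H : SimpleGraph W} {H' : SimpleGraph W'} (e : H ≃g H')
    {δ : ℕ∞} (h : IsSlim H' δ) : IsSlim H δ := by
  have hdist : ∀ x y, H'.edist (e x) (e y) = H.edist x y := by
    intro x y
    refine le_antisymm (edist_map_le e.toHom x y) ?_
    have := edist_map_le e.symm.toHom (e x) (e y)
    simpa using this
  have hshort : ∀ {x y : W} (p : H.Walk x y), IsShortest p → IsShortest (p.map e.toHom) := by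
    intro x y p hp
    have hp' : p.length = H.dist x y := hp
    change (p.map e.toHom).length = (H'.edist (e x) (e y)).toNat
    rw [hdist, Walk.length_map]
    exact hp'
  have hside : ∀ {x y x' y' x'' y'' : W} (p : H.Walk x y) (q : H.Walk x' y') (r : H.Walk x'' y''),
      SideClose H' δ (p.map e.toHom).support (q.map e.toHom).support (r.map e.toHom).support →
        SideClose H δ p.support q.support r.support := by
    intro x y x' y' x'' y'' p q r hpqr u hu
    obtain ⟨v, hv, hd⟩ := hpqr (e u) (by
      rw [Walk.support_map]
      exact List.mem_map_of_mem hu)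
    rw [Walk.support_map, Walk.support_map, List.mem_map, List.mem_map] at hv
    rcases hv with ⟨v', hv', rfl⟩ | ⟨v', hv', rfl⟩
    · exact ⟨v', Or.inl hv', (hdist u v').symm.trans_le hd⟩
    · exact ⟨v', Or.inr hv', (hdist u v').symm.trans_le hd⟩
  intro x y z p q r hp hq hr
  obtain ⟨h₁, h₂, h₃⟩ := h _ _ _ _ _ _ (hshort p hp) (hshort q hq) (hshort r hr)
  exact ⟨hside _ _ _ h₁, hside _ _ _ h₂, hside _ _ _ h₃⟩

theorem not_isSlim_one {W : Type*} {H : SimpleGraph W} {x y z a : W} {p : H.Walk x y}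
    {q : H.Walk x z} {r : H.Walk y z} (hp : IsShortest p) (hq : IsShortest q) (hr : IsShortest r)
    (ha : a ∈ p.support) (hqa : ∀ u ∈ q.support, Apart H a u)
    (hra : ∀ u ∈ r.support, Apart H a u) : ¬ IsSlim H 1 := by
  intro h
  obtain ⟨v, hv, hd⟩ := (h x y z p q r hp hq hr).1 a ha
  have hav : Apart H a v := hv.elim (hqa v) (hra v)
  rw [edist_le_one_iff_adj_or_eq] at hd
  exact hd.elim hav.2 hav.1

/-- The data by which the sides of a triangle cross the arm `A`: the function `h` changes by at
most one along edges, and the ends `p`, `q` lie at height `n` above `y` and `z`. One side descends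
from `p` to `y`, the other from `q` to `z` without meeting `p`; the points `y` and `z` are equal or
adjacent. -/
structure Tower (A : Arm) (n : ℕ) (y z : A.V) (h : A.V → ℕ) : Prop where
  lipschitz : ∀ u v, A.graph.Adj u v → h v ≤ h u + 1
  height_y : h y = 0
  height_z : h z = 0
  height_p : h A.p = n
  height_q : h A.q = n
  left : ∃ w : A.graph.Walk A.p y, w.length = n
  right : ∃ w : A.graph.Walk A.q z, w.length = n ∧ A.p ∉ w.support
  base : ∃ w : A.graph.Walk y z, w.length ≤ 1 ∧ A.p ∉ w.support

theorem tower_dottedArm (e : Bool) :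
    Tower (dottedArm e) 1 (none : Option Bool) (none : Option Bool)
      (fun s : Option Bool => s.elim 0 fun _ => 1) where
  lipschitz := by
    rintro (_ | β) (_ | γ) - <;> simp
  height_y := rfl
  height_z := rfl
  height_p := rfl
  height_q := rfl
  left := ⟨((dottedGraph_adj_none e false).symm).toWalk, rfl⟩
  right := by
    refine ⟨((dottedGraph_adj_none e true).symm).toWalk, rfl, ?_⟩
    intro h
    have h' : (some false : Option Bool) ∈ [some true, none] := h
    simp at h'
  base := by
    refine ⟨Walk.nil, Nat.zero_le _, ?_⟩
    intro h
    have h' : (some false : Option Bool) ∈ [none] := h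
    simp at h'

theorem exists_walk_building (k : ℕ) (β : Bool) (j : ℕ) (i : Fin (k + 1)) (hij : i.val + j = k) :
    ∃ w : (buildingGraph k).Walk (some (i, β)) none, w.length = j + 1 ∧
      ∀ s ∈ w.support, s = none ∨ ∃ i', s = some (i', β) := by
  induction j generalizing i with
  | zero =>
    have hadj : (buildingGraph k).Adj (some (i, β)) none :=
      ((buildingGraph_adj_none k i β).2 (Fin.ext hij)).symm
    refine ⟨hadj.toWalk, rfl, fun s hs => ?_⟩
    have hs' : s ∈ [some (i, β), none] := hs
    simp only [List.mem_cons, List.not_mem_nil, or_false] at hs'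
    rcases hs' with rfl | rfl
    · exact Or.inr ⟨i, rfl⟩
    · exact Or.inl rfl
  | succ j ih =>
    obtain ⟨w, hw, hs⟩ := ih ⟨i.val + 1, by omega⟩ (by simp only []; omega)
    have hadj : (buildingGraph k).Adj (some (i, β)) (some (⟨i.val + 1, by omega⟩, β)) :=
      (buildingGraph_adj_some k _ _ β β).2 (Or.inl ⟨rfl, Or.inl rfl⟩)
    refine ⟨Walk.cons hadj w, by rw [Walk.length_cons, hw], fun s hs' => ?_⟩
    rw [Walk.support_cons, List.mem_cons] at hs'
    rcases hs' with rfl | hs'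
    · exact Or.inr ⟨i, rfl⟩
    · exact hs s hs'

theorem tower_building (k : ℕ) :
    Tower (building k) (k + 1) (none : Option (Fin (k + 1) × Bool))
      (none : Option (Fin (k + 1) × Bool))
      (fun s : Option (Fin (k + 1) × Bool) => s.elim 0 fun x => k + 1 - x.1.val) where
  lipschitz := by
    have h₁ := buildingGraph_adj_none k
    have h₂ := buildingGraph_adj_some k
    rintro (_ | ⟨i, β⟩) (_ | ⟨j, γ⟩) h
    · simp
    · have := (h₁ j γ).1 h
      subst this
      simp
    · simp
    · have := (h₂ i j β γ).1 h
      simp only [Option.elim_some]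
      rcases this with ⟨-, h⟩ | ⟨rfl, -⟩ <;> omega
  height_y := rfl
  height_z := rfl
  height_p := rfl
  height_q := rfl
  left := by
    obtain ⟨w, hw, -⟩ := exists_walk_building k false k 0 (by simp)
    exact ⟨w, hw⟩
  right := by
    obtain ⟨w, hw, hs⟩ := exists_walk_building k true k 0 (by simp)
    refine ⟨w, hw, fun h => ?_⟩
    have h' : (some (0, false) : Option (Fin (k + 1) × Bool)) ∈ w.support := h
    simpa using hs _ h'
  base := by
    refine ⟨Walk.nil, Nat.zero_le _, ?_⟩
    intro h
    have h' : (some (0, false) : Option (Fin (k + 1) × Bool)) ∈ [none] := h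
    simp at h'

theorem IsRoof.exists_tower {A : Arm} (hA : IsRoof A) : ∃ n y h, Tower A n y y h := by
  rcases hA with ⟨e, rfl⟩ | ⟨k, rfl⟩
  · exact ⟨_, _, _, tower_dottedArm e⟩
  · exact ⟨_, _, _, tower_building (k + 1)⟩

theorem tower_squareArm :
    Tower squareArm 1 ((1, false) : Fin 2 × Bool) ((1, true) : Fin 2 × Bool)
      (fun s : Fin 2 × Bool => 1 - s.1.val) where
  lipschitz := by
    intro u v _
    omega
  height_y := rfl
  height_z := rfl
  height_p := rfl
  height_q := rfl
  left := by
    have hadj : (ladder 1).Adj (0, false) (1, false) := (ladder_adj 1 _ _ _ _).2 (by simp)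
    exact ⟨hadj.toWalk, rfl⟩
  right := by
    have hadj : (ladder 1).Adj (0, true) (1, true) := (ladder_adj 1 _ _ _ _).2 (by simp)
    refine ⟨hadj.toWalk, rfl, fun h => ?_⟩
    have h' : ((0, false) : Fin 2 × Bool) ∈ [((0, true) : Fin 2 × Bool), (1, true)] := h
    simp at h'
  base := by
    have hadj : (ladder 1).Adj (1, false) (1, true) := (ladder_adj 1 _ _ _ _).2 (by simp)
    refine ⟨hadj.toWalk, le_rfl, fun h => ?_⟩
    have h' : ((0, false) : Fin 2 × Bool) ∈ [((1, false) : Fin 2 × Bool), (1, true)] := h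
    simp at h'

theorem isShortest_of_length_le_one {W : Type*} {H : SimpleGraph W} {x y : W} (p : H.Walk x y)
    (hp : p.length ≤ 1) : IsShortest p := by
  rcases Nat.lt_or_ge p.length 1 with h | h
  · exact le_antisymm (by omega) (dist_le p)
  · have h1 : p.length = 1 := le_antisymm hp h
    change p.length = H.dist x y
    rw [h1, dist_eq_one_iff_adj.2 (Walk.adj_of_length_eq_one h1)]

/-- The triangle that is not slim runs from the top of `A` over `c`, `a`, `b` to the arm `B` on one
side, and over `w`, `t`, `v` on the other. -/
theorem not_isSlim_twoArms {A B : Arm} {n m : ℕ} {x : A.V} {y z : B.V} {hA : A.V → ℕ}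
    {hB : B.V → ℕ} (tA : Tower A n x x hA) (tB : Tower B m y z hB) :
    ¬ IsSlim (twoArms A B) 1 := by
  obtain ⟨pA, hpA⟩ := tA.left
  obtain ⟨qA, hqA, hqA'⟩ := tA.right
  obtain ⟨pB, hpB⟩ := tB.left
  obtain ⟨qB, hqB, hqB'⟩ := tB.right
  obtain ⟨rB, hrB, hrB'⟩ := tB.base
  let ιA : A.graph →g twoArms A B :=
    ⟨fun s => .inl (.inl s), fun {s s'} h => (twoArms_adj_AA A B s s').2 h⟩
  let ιB : B.graph →g twoArms A B :=
    ⟨fun s => .inl (.inr s), fun {s s'} h => (twoArms_adj_BB A B s s').2 h⟩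
  have hac : (twoArms A B).Adj (.inr 0) (ιA A.p) := (twoArms_adj_aA A B _).2 rfl
  have hab : (twoArms A B).Adj (.inr 0) (ιB B.p) := (twoArms_adj_aB A B _).2 rfl
  have htw : (twoArms A B).Adj (.inr 1) (ιA A.q) := (twoArms_adj_tA A B _).2 (Or.inr rfl)
  have htv : (twoArms A B).Adj (.inr 1) (ιB B.q) := (twoArms_adj_tB A B _).2 (Or.inr rfl)
  let P := (pA.map ιA).reverse.append (Walk.cons hac.symm (Walk.cons hab (pB.map ιB)))
  let Q := (qA.map ιA).reverse.append (Walk.cons htw.symm (Walk.cons htv (qB.map ιB)))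
  let f : (A.V ⊕ B.V) ⊕ Fin 2 → ℕ :=
    Sum.elim (Sum.elim hA fun s => n + 2 + m - hB s) fun _ => n + 1
  have hrl : ∀ i s, (twoArms A B).Adj (.inr i) (.inl s) →
      f (.inl s) ≤ f (.inr i) + 1 ∧ f (.inr i) ≤ f (.inl s) + 1 := by
    have hA' : ∀ s, s = A.p ∨ s = A.q → hA s = n := by
      rintro s (rfl | rfl)
      · exact tA.height_p
      · exact tA.height_q
    have hB' : ∀ s, s = B.p ∨ s = B.q → hB s = m := by
      rintro s (rfl | rfl)
      · exact tB.height_p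
      · exact tB.height_q
    rintro i (s | s) h
    · have : hA s = n := by
        fin_cases i
        · exact hA' s (Or.inl ((twoArms_adj_aA A B s).1 h))
        · exact hA' s ((twoArms_adj_tA A B s).1 h)
      simp only [f, Sum.elim_inl, Sum.elim_inr]
      omega
    · have : hB s = m := by
        fin_cases i
        · exact hB' s (Or.inl ((twoArms_adj_aB A B s).1 h))
        · exact hB' s ((twoArms_adj_tB A B s).1 h)
      simp only [f, Sum.elim_inl, Sum.elim_inr]
      omega
  have hf : ∀ u v, (twoArms A B).Adj u v → f v ≤ f u + 1 := by
    rintro (u | i) (v | j) h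
    · rcases u with u | u <;> rcases v with v | v
      · exact tA.lipschitz u v ((twoArms_adj_AA A B u v).1 h)
      · exact (twoArms_adj_AB A B u v h).elim
      · exact (twoArms_adj_AB A B v u h.symm).elim
      · have := tB.lipschitz v u ((twoArms_adj_BB A B u v).1 h).symm
        simp only [f, Sum.elim_inl, Sum.elim_inr]
        omega
    · exact (hrl j u h.symm).2
    · exact (hrl i v h).1
    · exact (twoArms_adj_rr A B i j h).elim
  have hP : IsShortest P := by
    refine isShortest_of_potential f hf P ?_
    have h₁ := tA.height_y
    have h₂ := tB.height_y
    simp only [P, f, ιA, ιB, Walk.length_append, Walk.length_reverse, Walk.length_map,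
      Walk.length_cons, RelHom.coeFn_mk, Sum.elim_inl, Sum.elim_inr]
    omega
  have hQ : IsShortest Q := by
    refine isShortest_of_potential f hf Q ?_
    have h₁ := tA.height_y
    have h₂ := tB.height_z
    simp only [Q, f, ιA, ιB, Walk.length_append, Walk.length_reverse, Walk.length_map,
      Walk.length_cons, RelHom.coeFn_mk, Sum.elim_inl, Sum.elim_inr]
    omega
  have hR : IsShortest (rB.map ιB) :=
    isShortest_of_length_le_one _ (by rwa [Walk.length_map])
  have haA : ∀ s, s ≠ A.p → Apart (twoArms A B) (.inr 0) (ιA s) := fun s hs =>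
    ⟨by rintro ⟨⟩, fun h => hs ((twoArms_adj_aA A B s).1 h)⟩
  have haB : ∀ s, s ≠ B.p → Apart (twoArms A B) (.inr 0) (ιB s) := fun s hs =>
    ⟨by rintro ⟨⟩, fun h => hs ((twoArms_adj_aB A B s).1 h)⟩
  refine not_isSlim_one (a := .inr 0) hP hQ hR ?_ ?_ ?_
  · simp [P]
  · intro u hu
    simp only [Q, Walk.mem_support_append_iff, Walk.support_reverse, List.mem_reverse,
      Walk.support_cons, List.mem_cons, Walk.support_map, List.mem_map] at hu
    rcases hu with ⟨s, hs, rfl⟩ | rfl | rfl | ⟨s, hs, rfl⟩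
    · exact haA s fun h => hqA' (h ▸ hs)
    · exact haA _ fun h => hqA' (h ▸ qA.start_mem_support)
    · exact ⟨by simp, twoArms_adj_rr A B _ _⟩
    · exact haB s fun h => hqB' (h ▸ hs)
  · intro u hu
    rw [Walk.support_map, List.mem_map] at hu
    obtain ⟨s, hs, rfl⟩ := hu
    exact haB s fun h => hrB' (h ▸ hs)

/-- The triangle that is not slim has its corners at the tops of the three arms; one side runs over
`c`, `a`, `b`, the other two over `w`, `t` and over `v`, `t'`. -/
theorem not_isSlim_threeArms {A B C : Arm} {n m k : ℕ} {x : A.V} {y : B.V} {z : C.V}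
    {hA : A.V → ℕ} {hB : B.V → ℕ} {hC : C.V → ℕ} (tA : Tower A n x x hA) (tB : Tower B m y y hB)
    (tC : Tower C k z z hC) : ¬ IsSlim (threeArms A B C) 1 := by
  obtain ⟨pA, hpA⟩ := tA.left
  obtain ⟨qA, hqA, hqA'⟩ := tA.right
  obtain ⟨pB, hpB⟩ := tB.left
  obtain ⟨qB, hqB, hqB'⟩ := tB.right
  obtain ⟨pC, hpC⟩ := tC.left
  obtain ⟨qC, hqC, -⟩ := tC.right
  let ιA : A.graph →g threeArms A B C :=
    ⟨fun s => .inl (.inl s), fun {s s'} h => (threeArms_adj_AA A B C s s').2 h⟩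
  let ιB : B.graph →g threeArms A B C :=
    ⟨fun s => .inl (.inr s), fun {s s'} h => (threeArms_adj_BB A B C s s').2 h⟩
  let ιC : C.graph →g threeArms A B C :=
    ⟨fun s => .inr (.inl s), fun {s s'} h => (threeArms_adj_CC A B C s s').2 h⟩
  have hac : (threeArms A B C).Adj (.inr (.inr ())) (ιA A.p) := (threeArms_adj_aA A B C _).2 rfl
  have hab : (threeArms A B C).Adj (.inr (.inr ())) (ιB B.p) := (threeArms_adj_aB A B C _).2 rfl
  have htw : (threeArms A B C).Adj (ιC C.p) (ιA A.q) :=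
    (threeArms_adj_CA A B C _ _).2 (Or.inr ⟨rfl, rfl⟩)
  have htv : (threeArms A B C).Adj (ιC C.q) (ιB B.q) :=
    (threeArms_adj_CB A B C _ _).2 (Or.inr ⟨rfl, rfl⟩)
  let P := (pA.map ιA).reverse.append (Walk.cons hac.symm (Walk.cons hab (pB.map ιB)))
  let Q := (qA.map ιA).reverse.append (Walk.cons htw.symm (pC.map ιC))
  let R := (qB.map ιB).reverse.append (Walk.cons htv.symm (qC.map ιC))
  -- All potentials needed below depend only on the heights within the arms.
  have hpot : ∀ (f : (A.V ⊕ B.V) ⊕ (C.V ⊕ Unit) → ℕ),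
      (∀ u v, A.graph.Adj u v → f (.inl (.inl v)) ≤ f (.inl (.inl u)) + 1) →
      (∀ u v, B.graph.Adj u v → f (.inl (.inr v)) ≤ f (.inl (.inr u)) + 1) →
      (∀ u v, C.graph.Adj u v → f (.inr (.inl v)) ≤ f (.inr (.inl u)) + 1) →
      (∀ r s, (r = .inr () ∨ r = .inl C.p ∨ r = .inl C.q) →
        (s = .inl A.p ∨ s = .inl A.q ∨ s = .inr B.p ∨ s = .inr B.q) →
        f (.inl s) ≤ f (.inr r) + 1 ∧ f (.inr r) ≤ f (.inl s) + 1) →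
      ∀ u v, (threeArms A B C).Adj u v → f v ≤ f u + 1 := by
    intro f fA fB fC fr
    have hrl : ∀ r s, (threeArms A B C).Adj (.inr r) (.inl s) →
        f (.inl s) ≤ f (.inr r) + 1 ∧ f (.inr r) ≤ f (.inl s) + 1 := by
      rintro (r | ⟨⟩) (s | s) h
      · rcases (threeArms_adj_CA A B C r s).1 h with ⟨rfl, rfl | rfl⟩ | ⟨rfl, rfl⟩ <;>
          exact fr _ _ (by simp) (by simp)
      · rcases (threeArms_adj_CB A B C r s).1 h with ⟨rfl, rfl | rfl⟩ | ⟨rfl, rfl⟩ <;>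
          exact fr _ _ (by simp) (by simp)
      · obtain rfl := (threeArms_adj_aA A B C s).1 h
        exact fr _ _ (by simp) (by simp)
      · obtain rfl := (threeArms_adj_aB A B C s).1 h
        exact fr _ _ (by simp) (by simp)
    rintro (u | u) (v | v) h
    · rcases u with u | u <;> rcases v with v | v
      · exact fA u v ((threeArms_adj_AA A B C u v).1 h)
      · exact (threeArms_adj_AB A B C u v h).elim
      · exact (threeArms_adj_AB A B C v u h.symm).elim
      · exact fB u v ((threeArms_adj_BB A B C u v).1 h)
    · exact (hrl v u h.symm).2
    · exact (hrl u v h).1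
    · rcases u with u | ⟨⟩ <;> rcases v with v | ⟨⟩
      · exact fC u v ((threeArms_adj_CC A B C u v).1 h)
      · exact (threeArms_adj_aC A B C u h.symm).elim
      · exact (threeArms_adj_aC A B C v h).elim
      · exact ((threeArms A B C).irrefl h).elim
  have eA := tA.height_y
  have eB := tB.height_y
  have eC := tC.height_y
  have eAp := tA.height_p
  have eAq := tA.height_q
  have eBp := tB.height_p
  have eBq := tB.height_q
  have eCp := tC.height_p
  have eCq := tC.height_q
  have hP : IsShortest P := by
    refine isShortest_of_potential (Sum.elim (Sum.elim hA fun s => n + 2 + m - hB s)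
      fun _ => n + 1) (hpot _ tA.lipschitz ?_ ?_ ?_) P ?_
    · intro u v h
      have := tB.lipschitz v u h.symm
      simp only [Sum.elim_inl, Sum.elim_inr]
      omega
    · simp
    · rintro r s - (rfl | rfl | rfl | rfl) <;> simp only [Sum.elim_inl, Sum.elim_inr] <;> omega
    · simp only [P, ιA, ιB, Walk.length_append, Walk.length_reverse, Walk.length_map,
        Walk.length_cons, RelHom.coeFn_mk, Sum.elim_inl, Sum.elim_inr]
      omega
  have hQ : IsShortest Q := by
    refine isShortest_of_potential (Sum.elim (Sum.elim hA fun _ => n + 1)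
      (Sum.elim (fun s => n + 1 + k - hC s) fun _ => n + 1)) (hpot _ tA.lipschitz ?_ ?_ ?_) Q ?_
    · simp
    · intro u v h
      have := tC.lipschitz v u h.symm
      simp only [Sum.elim_inl, Sum.elim_inr]
      omega
    · rintro r s (rfl | rfl | rfl) (rfl | rfl | rfl | rfl) <;>
        simp only [Sum.elim_inl, Sum.elim_inr] <;> omega
    · simp only [Q, ιA, ιC, Walk.length_append, Walk.length_reverse, Walk.length_map,
        Walk.length_cons, RelHom.coeFn_mk, Sum.elim_inl, Sum.elim_inr]
      omega
  have hR : IsShortest R := by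
    refine isShortest_of_potential (Sum.elim (Sum.elim (fun _ => m + 1) hB)
      (Sum.elim (fun s => m + 1 + k - hC s) fun _ => m + 1)) (hpot _ ?_ tB.lipschitz ?_ ?_) R ?_
    · simp
    · intro u v h
      have := tC.lipschitz v u h.symm
      simp only [Sum.elim_inl, Sum.elim_inr]
      omega
    · rintro r s (rfl | rfl | rfl) (rfl | rfl | rfl | rfl) <;>
        simp only [Sum.elim_inl, Sum.elim_inr] <;> omega
    · simp only [R, ιB, ιC, Walk.length_append, Walk.length_reverse, Walk.length_map,
        Walk.length_cons, RelHom.coeFn_mk, Sum.elim_inl, Sum.elim_inr]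
      omega
  have haA : ∀ s, s ≠ A.p → Apart (threeArms A B C) (.inr (.inr ())) (ιA s) := fun s hs =>
    ⟨by rintro ⟨⟩, fun h => hs ((threeArms_adj_aA A B C s).1 h)⟩
  have haB : ∀ s, s ≠ B.p → Apart (threeArms A B C) (.inr (.inr ())) (ιB s) := fun s hs =>
    ⟨by rintro ⟨⟩, fun h => hs ((threeArms_adj_aB A B C s).1 h)⟩
  have haC : ∀ s, Apart (threeArms A B C) (.inr (.inr ())) (ιC s) := fun s =>
    ⟨by rintro ⟨⟩, threeArms_adj_aC A B C s⟩
  refine not_isSlim_one (a := .inr (.inr ())) hP hQ hR ?_ ?_ ?_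
  · simp [P]
  · intro u hu
    simp only [Q, Walk.mem_support_append_iff, Walk.support_reverse, List.mem_reverse,
      Walk.support_cons, List.mem_cons, Walk.support_map, List.mem_map] at hu
    rcases hu with ⟨s, hs, rfl⟩ | rfl | ⟨s, hs, rfl⟩
    · exact haA s fun h => hqA' (h ▸ hs)
    · exact haA _ fun h => hqA' (h ▸ qA.start_mem_support)
    · exact haC s
  · intro u hu
    simp only [R, Walk.mem_support_append_iff, Walk.support_reverse, List.mem_reverse,
      Walk.support_cons, List.mem_cons, Walk.support_map, List.mem_map] at hu
    rcases hu with ⟨s, hs, rfl⟩ | rfl | ⟨s, hs, rfl⟩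
    · exact haB s fun h => hqB' (h ▸ hs)
    · exact haB _ fun h => hqB' (h ▸ qB.start_mem_support)
    · exact haC s

theorem Forbidden.not_isSlim {W : Type} {H : SimpleGraph W} (h : Forbidden H) :
    ¬ IsSlim H 1 := by
  have hd : ∀ e, IsRoof (dottedArm e) := fun e => Or.inl ⟨e, rfl⟩
  have hb : ∀ k, IsRoof (building (k + 1)) := fun k => Or.inr ⟨k, rfl⟩
  have two : ∀ {A B : Arm}, IsRoof A → (∃ m y z h, Tower B m y z h) →
      ¬ IsSlim (twoArms A B) 1 := by
    intro A B hA ⟨m, y, z, hB, tB⟩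
    obtain ⟨n, x, hA, tA⟩ := hA.exists_tower
    exact not_isSlim_twoArms tA tB
  have roof : ∀ {B : Arm}, IsRoof B → ∃ m y z h, Tower B m y z h := by
    intro B hB
    obtain ⟨m, y, h, t⟩ := hB.exists_tower
    exact ⟨m, y, y, h, t⟩
  have three : ∀ {A B C : Arm}, IsRoof A → IsRoof B → IsRoof C →
      ¬ IsSlim (threeArms A B C) 1 := by
    intro A B C hA hB hC
    obtain ⟨n, x, hA, tA⟩ := hA.exists_tower
    obtain ⟨m, y, hB, tB⟩ := hB.exists_tower
    obtain ⟨k, z, hC, tC⟩ := hC.exists_tower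
    exact not_isSlim_threeArms tA tB tC
  cases h with
  | two_dotted_dotted d e => exact two (hd d) (roof (hd e))
  | two_building_dotted k e => exact two (hb k) (roof (hd e))
  | two_dotted_square d => exact two (hd d) ⟨_, _, _, _, tower_squareArm⟩
  | two_building_square k => exact two (hb k) ⟨_, _, _, _, tower_squareArm⟩
  | three_dotted_dotted_dotted d e f => exact three (hd d) (hd e) (hd f)
  | three_building_dotted_dotted k e f => exact three (hb k) (hd e) (hd f)
  | three_dotted_dotted_building d e m => exact three (hd d) (hd e) (hb m)
  | three_building_building_dotted k l f => exact three (hb k) (hb l) (hd f)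
  | three_building_dotted_building k e m => exact three (hb k) (hd e) (hb m)
  | three_building_building_building k l m => exact three (hb k) (hb l) (hb m)

end SlimGraph

theorem mainTheorem2 {V : Type*} (G : SimpleGraph V) (hG : SlimGraph.IsKChordal 4 G) :
    (SlimGraph.slimness G ≤ 1 ∧ ∀ s : Set V, SlimGraph.slimness (G.induce s) ≤ 1) ↔
      ∀ {W : Type} (H : SimpleGraph W), SlimGraph.Forbidden H → ¬ H.IsIndContained G := by
  constructor
  · rintro ⟨-, h⟩ W H hH hcont
    obtain ⟨s, ⟨e⟩⟩ := SimpleGraph.isIndContained_iff_exists_iso_induce.1 hcont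
    exact hH.not_isSlim (SlimGraph.IsSlim.of_iso e (SlimGraph.slimness_le_iff.1 (h s)))
  · intro h
    have hG' : ¬ SlimGraph.HasForbidden G := fun ⟨W, H, hH, hcont⟩ => h H hH hcont
    exact ⟨SlimGraph.slimness_le_iff.2 (SlimGraph.isSlim_one_of_not_hasForbidden hG hG'),
      fun s => SlimGraph.slimness_le_iff.2 (SlimGraph.isSlim_one_of_not_hasForbidden
        (hG.induce s) fun h' => hG' h'.of_induce)⟩
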